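/- Let $X$ be a complex Banach space, $I=[0,1]$, $\Delta=\{(s,t)\in I^2: s\le t\}$. **Definitions.** For linear operators $A(t):D(A(t))\subset X\to X$ ($t\in I$), an *evolution system for $A$ on $D(A(t))$* is a family of bounded operators $U(t,s)$ on $X$, $(s,t)\in\Delta$, such that (i) for all $s\in[0,1)$ and $y\in D(A(s))$ the map $[s,1]\ni t\mapsto x(t)=U(t,s)y$ is continuously differentiable with $x(t)\in D(A(t))$ and $x'(t)=A(t)x(t)$ for all $t \in [s,1]$, and $x(s)=y$; (ii) $U(t,s)U(s,r)=U(t,r)$ for $(r,s),(s,t)\in\Delta$ and $\Delta\ni(s,t)\mapsto U(t,s)x$ is continuous for every $x\in X$. A bounded projection $P$ is *associated* with a closed densely defined operator $A$ with $\rho(A)\neq\emptyset$ and a nonempty compact isolated subset $\sigma$ of $\sigma(A)$ if $P$ commutes with $A$ (that is, $PA\subset AP$), $PD(A)=PX$, $\sigma(A|_{PD(A)})=\sigma$ and $\sigma(A|_{(1-P)D(A)})=\sigma(A)\setminus\sigma$, where the restrictions are operators in $PX$ and $(1-P)X$. For subsets $\sigma(t)\subset\sigma(A(t))$, $\sigma(\cdot)$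 *falls into* $\sigma(A(\cdot))\setminus\sigma(\cdot)$ at $t_0\in I$ if there are $t_n\in I$ with $t_n\to t_0$ and $\operatorname{dist}(\sigma(t_n),\sigma(A(t_n))\setminus\sigma(t_n))\to0$ (the distance to or from the empty set being $\infty$). A set-valued map $t\mapsto\sigma(t)$ on $S\subset I$ is *continuous* if for all $t_0\in S$ and $\delta>0$ one has $\sigma(t)\subset B_\delta(\sigma(t_0))$ and $\sigma(t_0)\subset B_\delta(\sigma(t))$ for all $t\in S$ close to $t_0$. A *cycle* is a finite formal sum of closed piecewise $C^1$ paths in $\mathbb C$, and $\operatorname n(\gamma,z)$ denotes the winding number of $\gamma$ about $z$. "Strongly" means: after application to each fixed $x\in X$; derivatives of operator-valued maps are strong derivatives. **Assumptions** (with $m\in\{0\}\cup\mathbb N\cup\{\infty\}$). 1. $A(t)$ is densely defined and closed for every $t\in I$; for every $\varepsilon\in(0,\infty)$ there is an evolution system $U_\varepsilon$ for $\frac1\varepsilon A$ on $D(A(t))$; and there is $M\in[1,\infty)$ with $\|U_\varepsilon(t,s)\|\le M$ for all $(s,t)\in\Delta$ and $\varepsilon\in(0,\infty)$. 2. $\sigma(t)$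 is a compact subset of $\sigma(A(t))$ for every $t\in I$; the set $N$ of points at which $\sigma(\cdot)$ falls into $\sigma(A(\cdot))\setminus\sigma(\cdot)$ has exactly $m$ elements and only finitely many accumulation points; and $I\setminus N\ni t\mapsto\sigma(t)$ is continuous. 3. For every $t_0\in I\setminus N$ there are a non-trivial compact interval $J_{t_0}\subset I$ that is a neighbourhood of $t_0$ in $I$ and a cycle $\gamma_{t_0}$ such that $\operatorname{ran}\gamma_{t_0}\subset\rho(A(t))$, $\operatorname n(\gamma_{t_0},z)=1$ for all $z\in\sigma(t)$ and $\operatorname n(\gamma_{t_0},z)=0$ for all $z\in\sigma(A(t))\setminus\sigma(t)$, for every $t\in J_{t_0}$; moreover $J_{t_0}\ni t\mapsto(z-A(t))^{-1}$ is strongly continuously differentiable for every $z\in\operatorname{ran}\gamma_{t_0}$, $\operatorname{ran}\gamma_{t_0}\ni z\mapsto\frac{d}{dt}(z-A(t))^{-1}$ is strongly continuous for every $t\in J_{t_0}$, and $$\sup_{(t,z)\in J_{t_0}\times\operatorname{ran}\gamma_{t_0}}\Big\|\frac{d}{dt}(z-A(t))^{-1}\Big\|<\infty .$$ 4. $P(t)$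 is the projection associated with $A(t)$ and $\sigma(t)$ for every $t\in I\setminus N$, and $I\setminus N\ni t\mapsto P(t)$ extends to a twice strongly continuously differentiable map on $I$, again denoted by $P$. **Conclusion.** Suppose that for every $\varepsilon\in(0,\infty)$ the evolution system $V_\varepsilon$ for $\frac1\varepsilon A+[P',P]$ exists on $D(A(t))$. Then $\sup_{t\in I}\|U_\varepsilon(t,0)-V_\varepsilon(t,0)\|$ is finite for every $\varepsilon\in(0,\infty)$, and, as $\varepsilon\searrow0$, $$\sup_{t\in I}\|U_\varepsilon(t,0)-V_\varepsilon(t,0)\|=\begin{cases}O(\varepsilon)&\text{if }m=0,\\ o(1)&\text{if }m\in\mathbb N\cup\{\infty\}.\end{cases}$$ -/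

import Mathlib

open Set Filter Topology Asymptotics

noncomputable section

namespace AdiabaticGap

/-- The time interval `I = [0,1]`. -/
abbrev I : Set ℝ := Icc (0 : ℝ) 1

/-- `Δ = {(s,t) ∈ I² : s ≤ t}`. -/
def Δ : Set (ℝ × ℝ) := {p | p.1 ∈ I ∧ p.2 ∈ I ∧ p.1 ≤ p.2}

section Operators

variable {X : Type*} [NormedAddCommGroup X] [NormedSpace ℂ X]

/-- `R` is the bounded two-sided inverse of `z - A : D(A) → X`. -/
def IsResolventAt (A : X →ₗ.[ℂ] X) (z : ℂ) (R : X →L[ℂ] X) : Prop :=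
  (∀ x : X, ∃ h : R x ∈ A.domain, z • R x - A ⟨R x, h⟩ = x) ∧
    ∀ x : A.domain, R (z • (x : X) - A x) = x

/-- The resolvent set `ρ(A)` of a possibly unbounded operator. -/
def resolventSet (A : X →ₗ.[ℂ] X) : Set ℂ := {z | ∃ R : X →L[ℂ] X, IsResolventAt A z R}

/-- The spectrum `σ(A)` of a possibly unbounded operator. -/
def spectrum (A : X →ₗ.[ℂ] X) : Set ℂ := (resolventSet A)ᶜ

open Classical in
/-- The resolvent `(z - A)⁻¹` (and `0` if `z ∉ ρ(A)`). -/
def resolvent (A : X →ₗ.[ℂ] X) (z : ℂ) : X →L[ℂ] X :=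
  if h : ∃ R : X →L[ℂ] X, IsResolventAt A z R then h.choose else 0

/-- The part of `A` in the subspace `W`: the operator in `W` with domain
`{w ∈ W ∩ D(A) : A w ∈ W}`. If `P` is a projection commuting with `A`, the part of `A` in
`P X` is the restriction of `A` to `P D(A)`. -/
def part (A : X →ₗ.[ℂ] X) (W : Submodule ℂ X) : W →ₗ.[ℂ] W where
  domain :=
    { carrier := {w | ∃ h : (w : X) ∈ A.domain, A ⟨w, h⟩ ∈ W}
      add_mem' := by
        rintro a b ⟨ha, ha'⟩ ⟨hb, hb'⟩
        refine ⟨A.domain.add_mem ha hb, ?_⟩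
        have := A.map_add ⟨a, ha⟩ ⟨b, hb⟩
        have h2 := W.add_mem ha' hb'
        rw [← this] at h2
        exact h2
      zero_mem' := by
        refine ⟨A.domain.zero_mem, ?_⟩
        have := A.map_zero
        exact this ▸ W.zero_mem
      smul_mem' := by
        rintro c a ⟨ha, ha'⟩
        refine ⟨A.domain.smul_mem c ha, ?_⟩
        have := A.map_smul c ⟨a, ha⟩
        have h2 := W.smul_mem c ha'
        rw [← this] at h2
        exact h2 }
  toFun :=
    { toFun := fun w => ⟨A ⟨((w : W) : X), w.2.1⟩, w.2.2⟩
      map_add' := fun a b => Subtype.ext (A.map_add ⟨_, a.2.1⟩ ⟨_, b.2.1⟩)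
      map_smul' := fun c a => Subtype.ext (A.map_smul c ⟨_, a.2.1⟩) }

/-- `P` is the (bounded) projection associated with `A` and the nonempty compact isolated
subset `σ` of the spectrum of `A`. -/
structure IsAssociatedProjection (A : X →ₗ.[ℂ] X) (σ : Set ℂ) (P : X →L[ℂ] X) : Prop where
  resolventSet_nonempty : (resolventSet A).Nonempty
  nonempty : σ.Nonempty
  isCompact : IsCompact σ
  subset_spectrum : σ ⊆ spectrum A
  isolated : ∃ r > 0, Metric.thickening r σ \ σ ⊆ resolventSet A
  idem : ∀ x, P (P x) = P x
  commutes : ∀ x : A.domain, ∃ h : P x ∈ A.domain, A ⟨P x, h⟩ = P (A x)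
  map_domain : A.domain.map (P : X →ₗ[ℂ] X) = LinearMap.range (P : X →ₗ[ℂ] X)
  spectrum_part : spectrum (part A (LinearMap.range (P : X →ₗ[ℂ] X))) = σ
  spectrum_compl : spectrum
    (part A (LinearMap.range ((1 - P : X →L[ℂ] X) : X →ₗ[ℂ] X))) = spectrum A \ σ

/-- `U` (with `U t s` standing for `U(t,s)`) is an evolution system on `I = [0,1]` for the
family `A` on the spaces `D(A(t))`. Values of `U` outside `Δ` are irrelevant. -/
structure IsEvolutionSystem (A : ℝ → X →ₗ.[ℂ] X) (U : ℝ → ℝ → X →L[ℂ] X) : Prop where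
  initial : ∀ s ∈ Ico (0 : ℝ) 1, ∀ y ∈ (A s).domain, U s s y = y
  contDiff : ∀ s ∈ Ico (0 : ℝ) 1, ∀ y ∈ (A s).domain,
    ContDiffOn ℝ 1 (fun t => U t s y) (Icc s 1)
  solves : ∀ s ∈ Ico (0 : ℝ) 1, ∀ y ∈ (A s).domain, ∀ t ∈ Icc s 1,
    ∃ h : U t s y ∈ (A t).domain,
      HasDerivWithinAt (fun τ => U τ s y) (A t ⟨U t s y, h⟩) (Icc s 1) t
  cocycle : ∀ r s t : ℝ, (r, s) ∈ Δ → (s, t) ∈ Δ → (U t s).comp (U s r) = U t r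
  continuous : ∀ x : X, ContinuousOn (fun p : ℝ × ℝ => U p.2 p.1 x) Δ

/-- The `A(t)` are densely defined closed operators, `U ε` is, for every `ε > 0`, the
evolution system for `(1/ε) A` on `D(A(t))`, and the `U ε` are bounded uniformly in `ε`. -/
structure HasBoundedEvolutions (A : ℝ → X →ₗ.[ℂ] X) (U : ℝ → ℝ → ℝ → X →L[ℂ] X) : Prop where
  dense : ∀ t ∈ I, Dense ((A t).domain : Set X)
  closed : ∀ t ∈ I, (A t).IsClosed
  evolution : ∀ ε : ℝ, 0 < ε →
    IsEvolutionSystem (fun t => ((1 / ε : ℝ) : ℂ) • A t) (U ε)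
  bounded : ∃ M : ℝ, 1 ≤ M ∧ ∀ ε : ℝ, 0 < ε → ∀ s t : ℝ, (s, t) ∈ Δ → ‖U ε t s‖ ≤ M

open Classical in
/-- The strong derivative at `t` of the operator-valued map `F` on `S ⊆ ℝ`: the bounded operator
`x ↦ d/dt (F(t)x)` (and `0` if there is no such operator). -/
def strongDeriv (F : ℝ → X →L[ℂ] X) (S : Set ℝ) (t : ℝ) : X →L[ℂ] X :=
  if h : ∃ D : X →L[ℂ] X, ∀ x, HasDerivWithinAt (fun s => F s x) (D x) S t then h.choose else 0

/-- On a Banach space, pointwise differentiability suffices for the strong derivative to be the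
genuine one. -/
theorem hasDerivWithinAt_strongDeriv [CompleteSpace X] {F : ℝ → X →L[ℂ] X} {S : Set ℝ} {t : ℝ}
    (ht : UniqueDiffWithinAt ℝ S t)
    (hF : ∀ x, DifferentiableWithinAt ℝ (fun s => F s x) S t) (x : X) :
    HasDerivWithinAt (fun s => F s x) (strongDeriv F S t x) S t := by
  have key : ∃ D : X →L[ℂ] X, ∀ x, HasDerivWithinAt (fun s => F s x) (D x) S t := by
    have hacc : (𝓝[S \ {t}] t).NeBot := by
      have := (uniqueDiffWithinAt_iff_accPt.1 ht)
      rwa [accPt_principal_iff_nhdsWithin] at this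
    obtain ⟨u, hu⟩ := exists_seq_tendsto (𝓝[S \ {t}] t)
    have hlim : Tendsto (fun n x => (((((u n - t)⁻¹ : ℝ) : ℂ) • (F (u n) - F t)) : X →L[ℂ] X) x)
        atTop (𝓝 fun x => derivWithin (fun s => F s x) S t) := by
      rw [tendsto_pi_nhds]
      intro y
      have h := ((hasDerivWithinAt_iff_tendsto_slope.1 (hF y).hasDerivWithinAt).comp hu)
      refine h.congr fun n => ?_
      simp only [slope, Function.comp_apply, vsub_eq_sub, smul_apply, sub_apply,
        Complex.coe_smul]
    refine ⟨continuousLinearMapOfTendsto _ hlim, fun y => ?_⟩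
    exact (hF y).hasDerivWithinAt
  unfold strongDeriv
  rw [dif_pos key]
  exact key.choose_spec x

/-- The commutator `[P'(t), P(t)]` with `P'` the strong derivative of `P` on `I`. -/
def commP (P : ℝ → X →L[ℂ] X) (t : ℝ) : X →L[ℂ] X :=
  (strongDeriv P I t).comp (P t) - (P t).comp (strongDeriv P I t)

end Operators

section Cycles

/-- A closed, piecewise continuously differentiable path in `ℂ`, parametrized by `[0,1]`.
Piecewise `C¹`: away from finitely many break points the path is `C¹` up to the boundary on
closed subintervals. -/
structure ClosedPath where
  toFun : ℝ → ℂ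
  continuousOn : ContinuousOn toFun (Icc 0 1)
  closed : toFun 0 = toFun 1
  piecewise : ∃ F : Finset ℝ, ∀ a b : ℝ, 0 ≤ a → a < b → b ≤ 1 →
    Disjoint (Ioo a b) (F : Set ℝ) → ContDiffOn ℝ 1 toFun (Icc a b)

/-- A cycle: a finite formal sum of closed paths (integer coefficients arise by repetition and by
reversal of paths). -/
abbrev Cycle := List ClosedPath

/-- The range `ran γ` of a cycle. -/
def Cycle.ran (γ : Cycle) : Set ℂ := {z | ∃ p ∈ γ, ∃ s ∈ Icc (0 : ℝ) 1, p.toFun s = z}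

/-- The index (winding number) `n(γ, z) = (1 / 2πi) ∫_γ dw / (w - z)` for `z ∉ ran γ`. -/
def Cycle.index (γ : Cycle) (z : ℂ) : ℂ :=
  (2 * Real.pi * Complex.I)⁻¹ *
    (γ.map fun p => ∫ s in (0 : ℝ)..1, deriv p.toFun s / (p.toFun s - z)).sum

end Cycles

section SetValued

/-- The distance of two subsets of `ℂ`, infinite if one of them is empty. -/
def setDist (S T : Set ℂ) : ENNReal := ⨅ z ∈ S, Metric.infEDist z T

/-- The set of points of `I` at which `σ(·)` falls into `τ(·)`. -/
def fallSet (σ τ : ℝ → Set ℂ) : Set ℝ :=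
  {t₀ | t₀ ∈ I ∧ ∃ u : ℕ → ℝ, (∀ n, u n ∈ I) ∧ Tendsto u atTop (𝓝 t₀) ∧
    Tendsto (fun n => setDist (σ (u n)) (τ (u n))) atTop (𝓝 0)}

/-- Continuity (upper and lower semicontinuity) on `S` of a set-valued map. -/
def SetContinuousOn (σ : ℝ → Set ℂ) (S : Set ℝ) : Prop :=
  ∀ t₀ ∈ S, ∀ δ > 0, ∀ᶠ t in 𝓝[S] t₀,
    σ t ⊆ Metric.thickening δ (σ t₀) ∧ σ t₀ ⊆ Metric.thickening δ (σ t)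

end SetValued

variable {X : Type*} [NormedAddCommGroup X] [NormedSpace ℂ X]

/-- The cycle `γ` lies in `ρ(A(t))` for all `t ∈ J` and has index `1` around `σ(t)` and index `0`
around the rest of the spectrum, and the resolvent of `A(t)` along `γ` is strongly continuously
differentiable in `t ∈ J`, with derivative strongly continuous in `z` and uniformly bounded. -/
structure IsRegularContour (A : ℝ → X →ₗ.[ℂ] X) (σ : ℝ → Set ℂ) (J : Set ℝ) (γ : Cycle) :
    Prop where
  ran_subset : ∀ t ∈ J, γ.ran ⊆ resolventSet (A t)
  index_one : ∀ t ∈ J, ∀ z ∈ σ t, γ.index z = 1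
  index_zero : ∀ t ∈ J, ∀ z ∈ spectrum (A t) \ σ t, γ.index z = 0
  contDiff : ∀ z ∈ γ.ran, ∀ x : X, ContDiffOn ℝ 1 (fun t => resolvent (A t) z x) J
  deriv_continuous : ∀ t ∈ J, ∀ x : X,
    ContinuousOn (fun z => strongDeriv (fun s => resolvent (A s) z) J t x) γ.ran
  deriv_bounded : ∃ C : ℝ, ∀ t ∈ J, ∀ z ∈ γ.ran,
    ‖strongDeriv (fun s => resolvent (A s) z) J t‖ ≤ C

/-- The spectral gap condition with parameter `m ∈ {0} ∪ ℕ ∪ {∞}`, the number of points at which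
`σ(·)` falls into `σ(A(·)) \ σ(·)`; here `P` is the extension to all of `I` of the family of
projections associated with `A(t)` and `σ(t)` at the remaining points. -/
structure SpectralGapCondition (m : ℕ∞) (A : ℝ → X →ₗ.[ℂ] X) (σ : ℝ → Set ℂ)
    (P : ℝ → X →L[ℂ] X) (U : ℝ → ℝ → ℝ → X →L[ℂ] X) : Prop where
  evolutions : HasBoundedEvolutions A U
  compact : ∀ t ∈ I, IsCompact (σ t)
  subset_spectrum : ∀ t ∈ I, σ t ⊆ spectrum (A t)
  fall_card : (fallSet σ fun t => spectrum (A t) \ σ t).encard = m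
  fall_acc : {t | AccPt t (𝓟 (fallSet σ fun t => spectrum (A t) \ σ t))}.Finite
  continuous : SetContinuousOn σ (I \ fallSet σ fun t => spectrum (A t) \ σ t)
  contours : ∀ t₀ ∈ I \ fallSet σ fun t => spectrum (A t) \ σ t,
    ∃ a b : ℝ, a < b ∧ Icc a b ⊆ I ∧ t₀ ∈ Icc a b ∧ Icc a b ∈ 𝓝[I] t₀ ∧
      ∃ γ : Cycle, IsRegularContour A σ (Icc a b) γ
  associated : ∀ t ∈ I \ fallSet σ fun t => spectrum (A t) \ σ t,
    IsAssociatedProjection (A t) (σ t) (P t)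
  regular : ∀ x : X, ContDiffOn ℝ 2 (fun t => P t x) I

end AdiabaticGap

end

/-!
The proof compares `U = U_ε` and `V = V_ε` through the defects `V(b,0) - U(b,a) V(a,0)`, which are
subadditive in the interval `[a,b]` up to the stability constant of `U`.

* As `V` solves the equation of `U` with the bounded perturbation `[P', P]`, a Gronwall argument
  bounds `V` uniformly in `ε`, and the defect is at most a constant times `b - a`
  (`IsEvolutionSystem.norm_le_of_perturbation`, `IsEvolutionSystem.norm_sub_comp_le`).
* If `B A - A B = [P', P]` on `[a,b]` with `B` bounded and Lipschitz in norm, then the terms of order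
  `ε⁻¹` cancel in the evolution of `(1 - ε B) V(·,0) x`, so the defect is of order `ε`
  (`IsEvolutionSystem.norm_sub_comp_le_of_commutator`). Only difference quotients along `V(·,0) x`
  are estimated, so that Lipschitz continuity of `B` suffices.
* Such a `B` exists locally away from the exceptional set
  (`SpectralGapCondition.exists_commutator_solution`). In terms of the resolvent `T = (z - A)⁻¹` at
  one point `z` of the contour the equation reads `B T - T B = T [P', P] T`, where the right-hand
  side is off-diagonal with respect to `P`. As the parts of `T` in the ranges of `P` and `1 - P`
  have disjoint spectra, it is uniquely solvable for off-diagonal `B`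
  (`isUnit_blockSylvester`): this is Gelfand theory in a commutative Banach algebra that contains
  left and right multiplication by `P` and `T`, and replaces contour integrals.
  Invertibility is an open condition and inversion preserves Lipschitz continuity, so `B` is Lipschitz in time.

Without exceptional points, compactness gives the order `ε` on all of `[0,1]`. Otherwise the defects
still tend to `0` locally away from the exceptional set; short intervals around isolated exceptional
points contribute little, and removing first these and then the finitely many accumulation points
gives convergence to `0` on `[0,1]` (`IsDefect.isSmallOn_of_finite_accPt`).
-/

noncomputable section

namespace AdiabaticGap

/-! ### Sylvester equations by Gelfand theory -/

section BanachAlgebra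

variable {𝔄 : Type*} [NormedRing 𝔄] [NormedAlgebra ℂ 𝔄]

/-- Commuting elements of a Banach algebra lie in a subalgebra (their bicommutant) that is closed,
commutative and inverse-closed; hence non-invertibility of its elements in the full algebra is
detected by characters of the subalgebra. -/
theorem exists_subalgebra_character [CompleteSpace 𝔄] {s : Set 𝔄}
    (hs : ∀ x ∈ s, ∀ y ∈ s, x * y = y * x) :
    ∃ S : Subalgebra ℂ 𝔄, s ⊆ S ∧ ∀ y : S, ¬ IsUnit (y : 𝔄) →
      ∃ φ : S →ₐ[ℂ] ℂ, φ y = 0 ∧ ∀ u : S, IsUnit (u : 𝔄) → φ u ≠ 0 := by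
  refine ⟨Subalgebra.centralizer ℂ (s.centralizer), Set.subset_centralizer_centralizer,
    fun y hy => ?_⟩
  have hclosed : IsClosed (Subalgebra.centralizer ℂ (s.centralizer) : Set 𝔄) := by
    rw [Subalgebra.coe_centralizer]
    have : Set.centralizer s.centralizer = ⋂ m ∈ s.centralizer, {x : 𝔄 | m * x = x * m} := by
      ext x; simp [Set.mem_centralizer_iff]
    rw [this]
    exact isClosed_biInter fun m _ => isClosed_eq (by fun_prop) (by fun_prop)
  let _ : NormedCommRing (Subalgebra.centralizer ℂ (s.centralizer)) :=
    { (inferInstance : NormedRing (Subalgebra.centralizer ℂ (s.centralizer))) with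
      mul_comm := fun a b => Subtype.ext
        (Set.centralizer_centralizer_comm_of_comm hs _ a.2 _ b.2) }
  have : CompleteSpace (Subalgebra.centralizer ℂ (s.centralizer)) := hclosed.completeSpace_coe
  have hy' : ¬ IsUnit y := fun h => hy
    (h.map (Subalgebra.centralizer ℂ (s.centralizer)).val)
  obtain ⟨f, hf⟩ := WeakDual.CharacterSpace.exists_apply_eq_zero hy'
  refine ⟨WeakDual.CharacterSpace.toAlgHom f, hf, ?_⟩
  rintro u ⟨v, hv⟩ h0
  have hmem : (↑v⁻¹ : 𝔄) ∈ Subalgebra.centralizer ℂ (s.centralizer) := by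
    rw [Subalgebra.mem_centralizer_iff]
    intro g hg
    have h1 : g * (v : 𝔄) = v * g := by
      rw [hv]; exact (Subalgebra.mem_centralizer_iff ℂ).1 u.2 g hg
    have h2 : Commute g (v : 𝔄) := h1
    exact h2.units_inv_right
  have h1 : u * ⟨_, hmem⟩ = 1 := Subtype.ext (by simp [← hv])
  have := congrArg (WeakDual.CharacterSpace.toAlgHom f) h1
  rw [map_mul, h0, map_one, zero_mul] at this
  exact zero_ne_one this

/-- On characters `p` and `q` take the values `0` and `1`. Where they agree, the displayed element
takes the value `1`; where they differ, it takes the value `r - l`, and the hypothesis for `ν = l`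
says that this does not vanish. -/
theorem isUnit_of_commuting_idempotents [CompleteSpace 𝔄] {p q l r : 𝔄}
    (hpq : p * q = q * p) (hpl : p * l = l * p) (hpr : p * r = r * p) (hql : q * l = l * q)
    (hqr : q * r = r * q) (hlr : l * r = r * l) (hp : p * p = p) (hq : q * q = q)
    (h : ∀ ν : ℂ, (IsUnit ((l - algebraMap ℂ 𝔄 ν) * p + (1 - p)) ∧
        IsUnit ((r - algebraMap ℂ 𝔄 ν) * q + (1 - q))) ∨
      (IsUnit ((l - algebraMap ℂ 𝔄 ν) * (1 - p) + p) ∧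
        IsUnit ((r - algebraMap ℂ 𝔄 ν) * (1 - q) + q))) :
    IsUnit (p * (r - l) * (1 - q) + (1 - p) * (r - l) * q + p * q + (1 - p) * (1 - q)) := by
  by_contra hnu
  have hcomm : ∀ x ∈ ({p, q, l, r} : Set 𝔄), ∀ y ∈ ({p, q, l, r} : Set 𝔄), x * y = y * x := by
    simp only [mem_insert_iff, mem_singleton_iff]
    rintro x (rfl | rfl | rfl | rfl) y (rfl | rfl | rfl | rfl) <;>
      first | rfl | assumption | (symm; assumption)
  obtain ⟨S, hsub, hS⟩ := exists_subalgebra_character hcomm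
  lift p to S using hsub (by simp)
  lift q to S using hsub (by simp)
  lift l to S using hsub (by simp)
  lift r to S using hsub (by simp)
  obtain ⟨φ, hφ, hu⟩ :=
    hS (p * (r - l) * (1 - q) + (1 - p) * (r - l) * q + p * q + (1 - p) * (1 - q)) hnu
  have hlp : φ p * φ p = φ p := by
    rw [← map_mul]; congr 1; exact Subtype.ext hp
  have hrp : φ q * φ q = φ q := by
    rw [← map_mul]; congr 1; exact Subtype.ext hq
  have k : ((φ l - φ l) * φ p + (1 - φ p) ≠ 0 ∧ (φ r - φ l) * φ q + (1 - φ q) ≠ 0) ∨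
      ((φ l - φ l) * (1 - φ p) + φ p ≠ 0 ∧ (φ r - φ l) * (1 - φ q) + φ q ≠ 0) := by
    rcases h (φ l) with ⟨h1, h2⟩ | ⟨h1, h2⟩
    · have k1 := hu ((l - algebraMap ℂ S (φ l)) * p + (1 - p)) h1
      have k2 := hu ((r - algebraMap ℂ S (φ l)) * q + (1 - q)) h2
      simp only [map_add, map_mul, map_sub, map_one, AlgHom.commutes, Algebra.algebraMap_self,
        RingHom.id_apply] at k1 k2
      exact Or.inl ⟨k1, k2⟩
    · have k1 := hu ((l - algebraMap ℂ S (φ l)) * (1 - p) + p) h1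
      have k2 := hu ((r - algebraMap ℂ S (φ l)) * (1 - q) + q) h2
      simp only [map_add, map_mul, map_sub, map_one, AlgHom.commutes, Algebra.algebraMap_self,
        RingHom.id_apply] at k1 k2
      exact Or.inr ⟨k1, k2⟩
  simp only [map_add, map_mul, map_sub, map_one] at hφ
  have h01 : ∀ w : ℂ, w * w = w → w = 0 ∨ w = 1 := fun w hw => by
    rcases eq_or_ne w 0 with h | h
    · exact Or.inl h
    · exact Or.inr (mul_left_cancel₀ h (by rw [hw, mul_one]))
  rcases h01 _ hlp with h1 | h1 <;> rcases h01 _ hrp with h2 | h2 <;> rw [h1, h2] at hφ k <;>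
    simp at hφ k
  all_goals exact k hφ

/-- The operator acting, for `T` commuting with the idempotent `p`, as `b ↦ b T - T b` on the blocks
`p b (1 - p)` and `(1 - p) b p` and as the identity on the blocks `p b p` and
`(1 - p) b (1 - p)`. Keeping the diagonal blocks makes it an operator on the whole algebra, which
can be inverted for `p` and `T` varying with a parameter. -/
def blockSylvester (p T : 𝔄) : 𝔄 →L[ℂ] 𝔄 :=
  let l := ContinuousLinearMap.mul ℂ 𝔄
  let r := (ContinuousLinearMap.mul ℂ 𝔄).flip
  l p * (r T - l T) * r (1 - p) + l (1 - p) * (r T - l T) * r p + l p * r p + l (1 - p) * r (1 - p)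

theorem blockSylvester_apply (p T b : 𝔄) :
    blockSylvester p T b = p * (b * (1 - p) * T - T * (b * (1 - p)))
      + (1 - p) * (b * p * T - T * (b * p)) + p * (b * p) + (1 - p) * (b * (1 - p)) := by
  rfl

/-- The Sylvester operator is invertible if `T` has disjoint spectra in the ranges of `p` and
`1 - p`: the hypothesis says that each `ν` is in the resolvent set of one of the two parts. -/
theorem isUnit_blockSylvester [CompleteSpace 𝔄] {p T : 𝔄} (hp : p * p = p) (hT : p * T = T * p)
    (h : ∀ ν : ℂ, IsUnit ((T - algebraMap ℂ 𝔄 ν) * p + (1 - p)) ∨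
      IsUnit ((T - algebraMap ℂ 𝔄 ν) * (1 - p) + p)) :
    IsUnit (blockSylvester p T) := by
  unfold blockSylvester
  set l := ContinuousLinearMap.mul ℂ 𝔄 with hl
  set r := (ContinuousLinearMap.mul ℂ 𝔄).flip with hr
  have l1 : l 1 = 1 := by ext; simp [hl]
  have r1 : r 1 = 1 := by ext; simp [hr]
  have lc : ∀ ν : ℂ, l (algebraMap ℂ 𝔄 ν) = algebraMap ℂ _ ν := fun ν => by
    ext; simp [hl, Algebra.algebraMap_eq_smul_one]
  have rc : ∀ ν : ℂ, r (algebraMap ℂ 𝔄 ν) = algebraMap ℂ _ ν := fun ν => by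
    ext; simp [hr, Algebra.algebraMap_eq_smul_one]
  have lm : ∀ a b, l (a * b) = l a * l b := fun a b => by ext; simp [hl, mul_assoc]
  have rm : ∀ a b, r (a * b) = r b * r a := fun a b => by ext; simp [hr, mul_assoc]
  have hlr : ∀ a b, l a * r b = r b * l a := fun a b => by ext; simp [hl, hr, mul_assoc]
  -- left and right multiplication by an invertible element are invertible
  have hlu : ∀ a : 𝔄, IsUnit a → IsUnit (l a) := by
    rintro _ ⟨u, rfl⟩
    exact ⟨⟨l u, l ↑u⁻¹, by rw [← lm, u.mul_inv, l1], by rw [← lm, u.inv_mul, l1]⟩, rfl⟩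
  have hru : ∀ a : 𝔄, IsUnit a → IsUnit (r a) := by
    rintro _ ⟨u, rfl⟩
    exact ⟨⟨r u, r ↑u⁻¹, by rw [← rm, u.inv_mul, r1], by rw [← rm, u.mul_inv, r1]⟩, rfl⟩
  simp only [map_sub, l1, r1]
  have hTc : ∀ ν : ℂ, (T - algebraMap ℂ 𝔄 ν) * p = p * (T - algebraMap ℂ 𝔄 ν) := fun ν => by
    rw [sub_mul, mul_sub, hT, Algebra.commutes]
  have hTc' : ∀ ν : ℂ, (T - algebraMap ℂ 𝔄 ν) * (1 - p) = (1 - p) * (T - algebraMap ℂ 𝔄 ν) :=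
    fun ν => by rw [mul_sub (T - _), sub_mul 1 p, hTc, mul_one, one_mul]
  refine isUnit_of_commuting_idempotents (hlr _ _) (by rw [← lm, ← lm, hT]) (hlr _ _)
    (hlr _ _).symm (by rw [← rm, ← rm, hT]) (hlr _ _) (by rw [← lm, hp]) (by rw [← rm, hp]) ?_
  intro ν
  refine (h ν).imp (fun h => ⟨?_, ?_⟩) (fun h => ⟨?_, ?_⟩)
  · simpa only [map_add, map_sub, lm, l1, lc] using hlu _ h
  · rw [hTc] at h
    simpa only [map_add, map_sub, rm, r1, rc] using hru _ h
  · simpa only [map_add, map_sub, lm, l1, lc] using hlu _ h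
  · rw [hTc'] at h
    simpa only [map_add, map_sub, rm, r1, rc] using hru _ h

/-- An off-diagonal `k` makes the diagonal blocks of the solution `b` vanish, so that `b` solves the
full commutator equation. -/
theorem commutator_equation_of_blockSylvester {p T k b : 𝔄} (hp : p * p = p)
    (hT : p * T = T * p) (h11 : p * k * p = 0) (h22 : (1 - p) * k * (1 - p) = 0)
    (hb : blockSylvester p T b = T * k * T) : b * T - T * b = T * k * T := by
  rw [blockSylvester_apply] at hb
  set q := 1 - p with hq
  have hqT : q * T = T * q := by rw [hq, sub_mul, mul_sub, hT]; simp
  have hqq : q * q = q := by rw [hq]; simp [sub_mul, mul_sub, hp]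
  have hpq : p * q = 0 := by rw [hq]; simp [mul_sub, hp]
  have hqp : q * p = 0 := by rw [hq]; simp [sub_mul, hp]
  have hpq1 : p + q = 1 := by rw [hq]; simp
  have h1 : p * b * p = 0 := by
    have h := congrArg (fun x => p * x * p) hb
    have e1 : p * (T * k * T) * p = 0 := by
      rw [show p * (T * k * T) * p = (p * T) * k * (T * p) by noncomm_ring, hT, ← hT,
        show p * T * k * (p * T) = (p * T) * k * (p * T) from rfl]
      nth_rewrite 1 [hT]
      rw [show T * p * k * (p * T) = T * (p * k * p) * T by noncomm_ring, h11]; simp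
    simp only [e1] at h
    rw [← h]
    have : p * (p * (b * q * T - T * (b * q)) + q * (b * p * T - T * (b * p)) + p * (b * p)
        + q * (b * q)) * p = p * p * b * (q * (T * p)) - p * p * T * b * (q * p)
        + (p * q) * (b * p * T - T * (b * p)) * p + (p * p) * b * (p * p) + (p * q) * b * q * p := by
      noncomm_ring
    rw [this, ← hT, ← mul_assoc q p T, hqp, hpq, hp]; simp
  have h2 : q * b * q = 0 := by
    have h := congrArg (fun x => q * x * q) hb
    have e1 : q * (T * k * T) * q = 0 := by
      rw [show q * (T * k * T) * q = (q * T) * k * (T * q) by noncomm_ring, ← hqT]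
      nth_rewrite 1 [hqT]
      rw [show T * q * k * (q * T) = T * (q * k * q) * T by noncomm_ring, h22]; simp
    simp only [e1] at h
    rw [← h]
    have : q * (p * (b * q * T - T * (b * q)) + q * (b * p * T - T * (b * p)) + p * (b * p)
        + q * (b * q)) * q = (q * p) * (b * q * T - T * (b * q)) * q
        + q * q * b * (p * (T * q)) - q * q * T * b * (p * q)
        + (q * p) * (b * p) * q + (q * q) * b * (q * q) := by
      noncomm_ring
    rw [this, ← hqT, ← mul_assoc p q T, hqp, hpq, hqq]; simp
  have hb' : b = p * b * q + q * b * p := by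
    calc b = (p + q) * b * (p + q) := by rw [hpq1]; simp
      _ = p * b * p + q * b * q + (p * b * q + q * b * p) := by noncomm_ring
      _ = _ := by rw [h1, h2]; simp
  have e : p * (b * q * T - T * (b * q)) + q * (b * p * T - T * (b * p)) + p * (b * p)
      + q * (b * q) = (p * b * q + q * b * p) * T - T * (p * b * q + q * b * p) + p * b * p
      + q * b * q := by
    have : p * (b * q * T - T * (b * q)) + q * (b * p * T - T * (b * p)) + p * (b * p)
      + q * (b * q) = (p * b * q + q * b * p) * T - ((p * T) * b * q + (q * T) * b * p)
        + p * b * p + q * b * q := by noncomm_ring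
    rw [this, hT, hqT]; noncomm_ring
  rw [e, h1, h2, ← hb'] at hb
  simpa using hb

end BanachAlgebra

/-! ### Bounded Lipschitz functions -/

section BoundedLipschitz

variable {E F G : Type*} [NormedAddCommGroup E] [NormedAddCommGroup F] [NormedAddCommGroup G]

/-- `f` is bounded and Lipschitz continuous on `J`. -/
def BoundedLipschitzOn (f : ℝ → E) (J : Set ℝ) : Prop :=
  ∃ K : ℝ, 0 ≤ K ∧ (∀ t ∈ J, ‖f t‖ ≤ K) ∧ ∀ s ∈ J, ∀ t ∈ J, ‖f t - f s‖ ≤ K * |t - s|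

namespace BoundedLipschitzOn

variable {J J' : Set ℝ} {f g : ℝ → E}

theorem mono (hf : BoundedLipschitzOn f J) (h : J' ⊆ J) : BoundedLipschitzOn f J' := by
  obtain ⟨K, h0, h1, h2⟩ := hf
  exact ⟨K, h0, fun t ht => h1 t (h ht), fun s hs t ht => h2 s (h hs) t (h ht)⟩

theorem const (c : E) : BoundedLipschitzOn (fun _ => c) J :=
  ⟨‖c‖, norm_nonneg _, fun _ _ => le_rfl, fun s _ t _ => by
    rw [sub_self, norm_zero]; positivity⟩

theorem add (hf : BoundedLipschitzOn f J) (hg : BoundedLipschitzOn g J) :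
    BoundedLipschitzOn (fun t => f t + g t) J := by
  obtain ⟨K, h0, h1, h2⟩ := hf
  obtain ⟨L, k0, k1, k2⟩ := hg
  refine ⟨K + L, by positivity, fun t ht => (norm_add_le _ _).trans
    (add_le_add (h1 t ht) (k1 t ht)), fun s hs t ht => ?_⟩
  rw [add_sub_add_comm, add_mul]
  exact (norm_add_le _ _).trans (add_le_add (h2 s hs t ht) (k2 s hs t ht))

theorem neg (hf : BoundedLipschitzOn f J) : BoundedLipschitzOn (fun t => - f t) J := by
  obtain ⟨K, h0, h1, h2⟩ := hf
  refine ⟨K, h0, fun t ht => by rw [norm_neg]; exact h1 t ht, fun s hs t ht => ?_⟩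
  rw [neg_sub_neg, norm_sub_rev]
  exact h2 s hs t ht

theorem sub (hf : BoundedLipschitzOn f J) (hg : BoundedLipschitzOn g J) :
    BoundedLipschitzOn (fun t => f t - g t) J := by
  simpa only [sub_eq_add_neg] using hf.add hg.neg

/-- A bounded bilinear expression in two bounded Lipschitz functions. -/
theorem bilin {f : ℝ → E} {g : ℝ → F} (m : E → F → G)
    (hm : ∀ a b, ‖m a b‖ ≤ ‖a‖ * ‖b‖) (hadd : ∀ a a' b, m (a - a') b = m a b - m a' b)
    (hadd' : ∀ a b b', m a (b - b') = m a b - m a b')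
    (hf : BoundedLipschitzOn f J) (hg : BoundedLipschitzOn g J) :
    BoundedLipschitzOn (fun t => m (f t) (g t)) J := by
  obtain ⟨K, h0, h1, h2⟩ := hf
  obtain ⟨L, k0, k1, k2⟩ := hg
  refine ⟨2 * K * L, by positivity, fun t ht => ?_, fun s hs t ht => ?_⟩
  · have := mul_le_mul (h1 t ht) (k1 t ht) (norm_nonneg _) h0
    refine (hm _ _).trans (this.trans ?_)
    nlinarith [mul_nonneg h0 k0]
  · have e : m (f t) (g t) - m (f s) (g s) = m (f t - f s) (g t) + m (f s) (g t - g s) := by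
      rw [hadd, hadd']; abel
    rw [e]
    have e1 := (hm (f t - f s) (g t)).trans
      (mul_le_mul (h2 s hs t ht) (k1 t ht) (norm_nonneg _) (by positivity))
    have e2 := (hm (f s) (g t - g s)).trans
      (mul_le_mul (h1 s hs) (k2 s hs t ht) (norm_nonneg _) h0)
    refine (norm_add_le _ _).trans ((add_le_add e1 e2).trans_eq ?_)
    ring

theorem mul {R : Type*} [NormedRing R] {f g : ℝ → R} (hf : BoundedLipschitzOn f J)
    (hg : BoundedLipschitzOn g J) : BoundedLipschitzOn (fun t => f t * g t) J :=
  bilin (fun a b => a * b) norm_mul_le sub_mul mul_sub hf hg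

theorem clm_apply {𝕜 V W : Type*} [NontriviallyNormedField 𝕜] [NormedAddCommGroup V]
    [NormedSpace 𝕜 V] [NormedAddCommGroup W] [NormedSpace 𝕜 W] {f : ℝ → V →L[𝕜] W} {g : ℝ → V}
    (hf : BoundedLipschitzOn f J) (hg : BoundedLipschitzOn g J) :
    BoundedLipschitzOn (fun t => f t (g t)) J :=
  bilin (fun (a : V →L[𝕜] W) b => a b) (fun a b => a.le_opNorm b) (fun _ _ _ => rfl)
    (fun _ _ _ => map_sub _ _ _) hf hg

theorem continuousOn (hf : BoundedLipschitzOn f J) : ContinuousOn f J := by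
  obtain ⟨K, h0, -, h2⟩ := hf
  have : LipschitzOnWith K.toNNReal f J := LipschitzOnWith.of_dist_le_mul fun s hs t ht => by
    rw [dist_eq_norm, Real.dist_eq, Real.coe_toNNReal _ h0]
    exact h2 t ht s hs
  exact this.continuousOn

/-- Near a point where a Lipschitz function with values in a Banach algebra is invertible, its
inverse is Lipschitz. -/
theorem inverse {R : Type*} [NormedRing R] [HasSummableGeomSeries R] {f : ℝ → R}
    (hf : BoundedLipschitzOn f J)
    {t₀ : ℝ} (ht₀ : t₀ ∈ J) (hu : IsUnit (f t₀)) :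
    ∃ δ > 0, (∀ t ∈ J ∩ Metric.ball t₀ δ, IsUnit (f t)) ∧
      BoundedLipschitzOn (fun t => Ring.inverse (f t)) (J ∩ Metric.ball t₀ δ) := by
  obtain ⟨u, hu⟩ := hu
  have hc : ContinuousWithinAt f J t₀ := hf.continuousOn t₀ ht₀
  have h1 : ∀ᶠ t in 𝓝[J] t₀, IsUnit (f t) :=
    hc.eventually (Units.isOpen.mem_nhds (hu ▸ u.isUnit))
  have h2 : ∀ᶠ t in 𝓝[J] t₀, ‖Ring.inverse (f t)‖ < ‖Ring.inverse (f t₀)‖ + 1 := by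
    have h3 : ContinuousAt Ring.inverse (f t₀) := hu ▸ NormedRing.inverse_continuousAt u
    have : Tendsto (fun t => ‖Ring.inverse (f t)‖) (𝓝[J] t₀) (𝓝 ‖Ring.inverse (f t₀)‖) :=
      (h3.tendsto.comp hc).norm
    exact this.eventually_lt_const (lt_add_one _)
  obtain ⟨δ, hδ, h⟩ := Metric.mem_nhdsWithin_iff.1 (h1.and h2)
  rw [inter_comm] at h
  obtain ⟨K, h0, -, hK⟩ := hf
  set M := ‖Ring.inverse (f t₀)‖ + 1 with hM
  have hM1 : 1 ≤ M := by rw [hM]; linarith [norm_nonneg (Ring.inverse (f t₀))]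
  refine ⟨δ, hδ, fun t ht => (h ht).1, M + M * K * M, by positivity, fun t ht => ?_,
    fun s hs t ht => ?_⟩
  · have := (h ht).2.le
    have : 0 ≤ M * K * M := by positivity
    linarith
  · have e : Ring.inverse (f t) - Ring.inverse (f s)
        = Ring.inverse (f t) * (f s - f t) * Ring.inverse (f s) := by
      rw [mul_sub, sub_mul, Ring.inverse_mul_cancel _ (h ht).1, mul_assoc,
        Ring.mul_inverse_cancel _ (h hs).1, mul_one, one_mul]
    have e1 : ‖f s - f t‖ ≤ K * |t - s| := by rw [norm_sub_rev]; exact hK s hs.1 t ht.1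
    rw [e]
    calc _ ≤ ‖Ring.inverse (f t)‖ * ‖f s - f t‖ * ‖Ring.inverse (f s)‖ :=
          (norm_mul_le _ _).trans (mul_le_mul_of_nonneg_right (norm_mul_le _ _) (norm_nonneg _))
      _ ≤ M * (K * |t - s|) * M := by
          have := (h ht).2.le; have := (h hs).2.le
          gcongr
      _ ≤ _ := by
          rw [add_mul]
          have : 0 ≤ M * |t - s| := by positivity
          nlinarith

end BoundedLipschitzOn

end BoundedLipschitz

/-! ### From strong to norm regularity -/

section StrongLipschitz

variable {X : Type*} [NormedAddCommGroup X] [NormedSpace ℂ X]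

/-- Strong Lipschitz continuity on a bounded set implies Lipschitz continuity in norm, by the
uniform boundedness principle. -/
theorem boundedLipschitzOn_of_strong [CompleteSpace X] {F : ℝ → X →L[ℂ] X} {a b : ℝ}
    (h : ∀ x, ∃ C, ∀ s ∈ Icc a b, ∀ t ∈ Icc a b, ‖F t x - F s x‖ ≤ C * |t - s|) :
    BoundedLipschitzOn F (Icc a b) := by
  rcases (Icc a b).eq_empty_or_nonempty with h0 | ⟨c, hc⟩
  · exact ⟨0, le_rfl, by simp [h0], by simp [h0]⟩
  obtain ⟨C, hC⟩ := banach_steinhaus (𝕜 := ℂ) (𝕜₂ := ℂ)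
    (g := fun p : Icc a b × Icc a b =>
      ((((p.2 : ℝ) - p.1 : ℝ) : ℂ)⁻¹ • (F p.2 - F p.1) : X →L[ℂ] X)) (by
    intro x
    obtain ⟨C, hC⟩ := h x
    refine ⟨max C 0, fun p => ?_⟩
    have := hC p.1 p.1.2 p.2 p.2.2
    rw [smul_apply, norm_smul, norm_inv, Complex.norm_real, Real.norm_eq_abs]
    rcases eq_or_ne ((p.2 : ℝ) - p.1) 0 with h0 | h0
    · rw [h0]; simp
    · have h1 : 0 < |(p.2 : ℝ) - p.1| := abs_pos.2 h0
      rw [inv_mul_le_iff₀ h1, mul_comm]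
      refine this.trans ?_
      gcongr
      exact le_max_left _ _)
  have hlip : ∀ s ∈ Icc a b, ∀ t ∈ Icc a b, ‖F t - F s‖ ≤ C * |t - s| := by
    intro s hs t ht
    have := hC (⟨s, hs⟩, ⟨t, ht⟩)
    rw [norm_smul, norm_inv, Complex.norm_real, Real.norm_eq_abs] at this
    rcases eq_or_ne t s with h0 | h0
    · rw [h0]; simp
    · have h1 : 0 < |t - s| := abs_pos.2 (sub_ne_zero.2 h0)
      rwa [inv_mul_le_iff₀ h1, mul_comm] at this
  have hC0 : 0 ≤ C := (norm_nonneg _).trans (hC (⟨c, hc⟩, ⟨c, hc⟩))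
  have hab : 0 ≤ b - a := by linarith [hc.1, hc.2]
  refine ⟨‖F c‖ + C * (b - a) + C, by positivity, fun t ht => ?_, fun s hs t ht => ?_⟩
  · have h1 := hlip c hc t ht
    have h2 : |t - c| ≤ b - a := abs_le.2 ⟨by linarith [ht.1, hc.2], by linarith [ht.2, hc.1]⟩
    have h3 : ‖F t‖ ≤ ‖F c‖ + ‖F t - F c‖ := by
      calc ‖F t‖ = ‖F c + (F t - F c)‖ := by congr 1; abel
        _ ≤ _ := norm_add_le _ _
    have h4 : C * |t - c| ≤ C * (b - a) := by gcongr
    linarith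
  · refine (hlip s hs t ht).trans ?_
    gcongr
    have : 0 ≤ C * (b - a) := by positivity
    linarith [norm_nonneg (F c)]

theorem boundedLipschitzOn_of_contDiffOn [CompleteSpace X] {F : ℝ → X →L[ℂ] X} {a b : ℝ}
    (hab : a < b) (h : ∀ x, ContDiffOn ℝ 1 (fun t => F t x) (Icc a b)) :
    BoundedLipschitzOn F (Icc a b) := by
  refine boundedLipschitzOn_of_strong fun x => ?_
  have hc := (h x).continuousOn_derivWithin (uniqueDiffOn_Icc hab) le_rfl
  obtain ⟨C, hC⟩ := isCompact_Icc.exists_bound_of_continuousOn hc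
  refine ⟨C, fun s hs t ht => ?_⟩
  exact (convex_Icc a b).norm_image_sub_le_of_norm_hasDerivWithin_le
    (fun r hr => (((h x).differentiableOn one_ne_zero) r hr).hasDerivWithinAt) hC hs ht

theorem boundedLipschitzOn_strongDeriv [CompleteSpace X] {F : ℝ → X →L[ℂ] X} {a b : ℝ}
    (hab : a < b) (h : ∀ x, ContDiffOn ℝ 2 (fun t => F t x) (Icc a b)) :
    BoundedLipschitzOn (strongDeriv F (Icc a b)) (Icc a b) := by
  refine boundedLipschitzOn_of_contDiffOn hab fun x => ?_
  have hd : ContDiffOn ℝ 1 (derivWithin (fun t => F t x) (Icc a b)) (Icc a b) :=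
    (h x).derivWithin (uniqueDiffOn_Icc hab) (by norm_num)
  refine hd.congr fun t ht => ?_
  have hu := uniqueDiffOn_Icc hab t ht
  exact ((hasDerivWithinAt_strongDeriv hu
    (fun y => ((h y).differentiableOn two_ne_zero) t ht) x).derivWithin hu).symm

/-- As `P` is twice strongly continuously differentiable, `P` and `P'`, hence `[P', P]`, are bounded
and Lipschitz in norm. -/
theorem boundedLipschitzOn_commP [CompleteSpace X] {P : ℝ → X →L[ℂ] X}
    (h : ∀ x, ContDiffOn ℝ 2 (fun t => P t x) I) : BoundedLipschitzOn (commP P) I := by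
  have h1 := boundedLipschitzOn_of_contDiffOn zero_lt_one fun x => (h x).of_le one_le_two
  have h2 := boundedLipschitzOn_strongDeriv zero_lt_one h
  exact (h2.mul h1).sub (h1.mul h2)

end StrongLipschitz

/-! ### Resolvents, parts of operators and associated projections -/

section Resolvent

variable {X : Type*} [NormedAddCommGroup X] [NormedSpace ℂ X] {A : X →ₗ.[ℂ] X}

theorem isResolventAt_resolvent {z : ℂ} (hz : z ∈ resolventSet A) :
    IsResolventAt A z (resolvent A z) := by
  unfold resolvent
  rw [dif_pos (show ∃ R : X →L[ℂ] X, IsResolventAt A z R from hz)]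
  exact Exists.choose_spec (p := fun R => IsResolventAt A z R) hz

/-- If `P` commutes with `A`, then it commutes with the resolvent of `A`. -/
theorem IsResolventAt.comm {z : ℂ} {T P : X →L[ℂ] X} (hT : IsResolventAt A z T)
    (hP : ∀ x : A.domain, ∃ h : P x ∈ A.domain, A ⟨P x, h⟩ = P (A x)) : P * T = T * P := by
  ext x
  obtain ⟨h, hx⟩ := hT.1 x
  obtain ⟨h', hx'⟩ := hP ⟨T x, h⟩
  have := hT.2 ⟨P (T x), h'⟩
  dsimp only at this hx'
  rw [hx', ← map_smul, ← map_sub, hx] at this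
  exact this.symm

/-- Spectral mapping for the resolvent `T = (z - A)⁻¹` on the range of `P`: there
`T - ν = -ν T (w - A)` with `w = z - ν⁻¹`, with inverse `-ν⁻¹ (1 + ν⁻¹ (w - A)⁻¹)`. -/
theorem isUnit_of_mem_resolventSet_part {z ν : ℂ} {T P : X →L[ℂ] X} (hT : IsResolventAt A z T)
    (hidem : P * P = P)
    (hP : ∀ x : A.domain, ∃ h : P x ∈ A.domain, A ⟨P x, h⟩ = P (A x)) (hν : ν ≠ 0)
    (hmem : z - ν⁻¹ ∈ resolventSet (part A (LinearMap.range (P : X →ₗ[ℂ] X)))) :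
    IsUnit ((T - algebraMap ℂ (X →L[ℂ] X) ν) * P + (1 - P)) := by
  obtain ⟨S, hS1, hS2⟩ := hmem
  have hPP : ∀ x, P (P x) = P x := fun x => by
    conv_rhs => rw [← hidem]
    rfl
  have hPr : ∀ x, P x ∈ LinearMap.range (P : X →ₗ[ℂ] X) := fun x => ⟨x, rfl⟩
  have hfix : ∀ w : LinearMap.range (P : X →ₗ[ℂ] X), P (w : X) = w := by
    rintro ⟨_, x, rfl⟩; exact hPP x
  have hcomm := hT.comm hP
  have hcomm' : ∀ x, P (T x) = T (P x) := fun x => DFunLike.congr_fun hcomm x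
  set S' : X →L[ℂ] X := (LinearMap.range (P : X →ₗ[ℂ] X)).subtypeL ∘L S ∘L
    (P.codRestrict _ hPr) with hS'
  have hPS : P * S' = S' := by ext x; exact hfix _
  have hSP : S' * P = S' := by
    ext x
    change ((S (P.codRestrict _ hPr (P x)) : LinearMap.range (P : X →ₗ[ℂ] X)) : X) =
      S (P.codRestrict _ hPr x)
    congr 2
    exact Subtype.ext (hPP x)
  -- the resolvent identity between `T` and the resolvent `S'` of the part of `A`
  have hTS : T * S' = ν • (S' - T * P) := by
    ext x
    obtain ⟨hmem, hx⟩ := hS1 (P.codRestrict _ hPr x)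
    obtain ⟨hd, -⟩ := id hmem
    have hx1 : (z - ν⁻¹) • S' x - A ⟨S' x, hd⟩ = P x := congrArg Subtype.val hx
    have h2 := hT.2 ⟨S' x, hd⟩
    have h3 : z • S' x - A ⟨S' x, hd⟩ = P x + ν⁻¹ • S' x := by
      rw [← hx1, sub_smul]; abel
    dsimp only at h2
    rw [h3, map_add, map_smul] at h2
    change T (S' x) = ν • (S' x - T (P x))
    rw [show S' x - T (P x) = ν⁻¹ • T (S' x) from sub_eq_iff_eq_add'.2 h2.symm, smul_smul, mul_inv_cancel₀ hν, one_smul]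
  have hST : S' * T = ν • (S' - T * P) := by
    ext x
    obtain ⟨h, hx⟩ := hT.1 (P x)
    have hd : A ⟨T (P x), h⟩ = z • T (P x) - P x := eq_sub_of_add_eq ((add_comm _ _).trans (sub_eq_iff_eq_add.1 hx).symm)
    have hw : (⟨T (P x), by rw [← hcomm']; exact hPr _⟩ : LinearMap.range (P : X →ₗ[ℂ] X)) ∈
        (part A (LinearMap.range (P : X →ₗ[ℂ] X))).domain := by
      refine ⟨h, ?_⟩
      dsimp only
      rw [hd]
      refine Submodule.sub_mem _ (Submodule.smul_mem _ _ ?_) (hPr _)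
      rw [← hcomm']; exact hPr _
    have h2 := hS2 ⟨_, hw⟩
    have h3 : (z - ν⁻¹) • (⟨T (P x), by rw [← hcomm']; exact hPr _⟩ :
          LinearMap.range (P : X →ₗ[ℂ] X)) - part A (LinearMap.range (P : X →ₗ[ℂ] X)) ⟨_, hw⟩
        = P.codRestrict _ hPr (x - ν⁻¹ • T x) := by
      apply Subtype.ext
      change (z - ν⁻¹) • T (P x) - A ⟨T (P x), h⟩ = P (x - ν⁻¹ • T x)
      rw [hd, map_sub, map_smul, hcomm', sub_smul]; abel
    dsimp only at h2
    rw [h3] at h2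
    have h4 : S' (x - ν⁻¹ • T x) = T (P x) := congrArg Subtype.val h2
    change S' (T x) = ν • (S' x - T (P x))
    rw [← h4, map_sub, map_smul, sub_sub_cancel, smul_smul, mul_inv_cancel₀ hν, one_smul]
  have e0 : (T - algebraMap ℂ (X →L[ℂ] X) ν) * P + (1 - P) = T * P - ν • P + (1 - P) := by
    rw [sub_mul, Algebra.algebraMap_eq_smul_one, smul_mul_assoc, one_mul]
  rw [e0]
  set V : X →L[ℂ] X := -(ν⁻¹ • (P + ν⁻¹ • S')) + (1 - P) with hV
  have hTP : T * P * P = T * P := by rw [mul_assoc, hidem]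
  have hPTP : P * (T * P) = T * P := by rw [← mul_assoc, hcomm, hTP]
  have hTPS : T * P * S' = ν • (S' - T * P) := by rw [mul_assoc, hPS, hTS]
  have hSTP : S' * (T * P) = ν • (S' - T * P) := by
    rw [← hcomm, ← mul_assoc, hSP, hST, hcomm]
  have c2 : ∀ Y : X →L[ℂ] X, ν⁻¹ • ν • Y = Y := fun Y => by
    rw [smul_smul, inv_mul_cancel₀ hν, one_smul]
  have c3 : ∀ Y : X →L[ℂ] X, ν • ν⁻¹ • Y = Y := fun Y => by
    rw [smul_smul, mul_inv_cancel₀ hν, one_smul]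
  refine ⟨⟨T * P - ν • P + (1 - P), V, ?_, ?_⟩, rfl⟩
  · simp only [hV, mul_add, add_mul, sub_mul, mul_sub, mul_neg, mul_smul_comm, smul_mul_assoc,
      smul_add, smul_sub, hTP, hTPS, hidem, hPS, mul_one, one_mul, c2]
    abel
  · simp only [hV, mul_add, add_mul, sub_mul, mul_sub, neg_mul, mul_smul_comm, smul_mul_assoc,
      smul_add, smul_sub, hSTP, hPTP, hSP, hidem, mul_one, one_mul, smul_neg, c2, c3]
    abel

/-- The parts of the resolvent `T` in the ranges of `P` and `1 - P` have disjoint spectra. For `ν = 0`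
this holds because `P D(A) = P X` makes `T` invertible on the range of `P`. -/
theorem IsAssociatedProjection.isUnit_or [CompleteSpace X] {σ : Set ℂ} {P T : X →L[ℂ] X} {z : ℂ}
    (hP : IsAssociatedProjection A σ P) (hT : IsResolventAt A z T) (ν : ℂ) :
    IsUnit ((T - algebraMap ℂ (X →L[ℂ] X) ν) * P + (1 - P)) ∨
      IsUnit ((T - algebraMap ℂ (X →L[ℂ] X) ν) * (1 - P) + P) := by
  have hidem : P * P = P := by ext x; exact hP.idem x
  have hcomm := hT.comm hP.commutes
  have hcomm' : ∀ x, P (T x) = T (P x) := fun x => DFunLike.congr_fun hcomm x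
  rcases eq_or_ne ν 0 with rfl | hν
  · left
    rw [ContinuousLinearMap.isUnit_iff_bijective]
    have hap : ∀ x, ((T - algebraMap ℂ (X →L[ℂ] X) 0) * P + (1 - P)) x = T (P x) + (x - P x) := by
      intro x; simp
    have hTinj : ∀ x, T x = 0 → x = 0 := fun x hx => by
      obtain ⟨h, hx'⟩ := hT.1 x
      have h0 : (⟨T x, h⟩ : A.domain) = 0 := Subtype.ext hx
      rw [h0, hx, A.map_zero] at hx'
      simpa using hx'.symm
    constructor
    · rw [injective_iff_map_eq_zero]
      intro x hx
      rw [hap] at hx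
      have h1 := congrArg P hx
      rw [map_add, hcomm', hP.idem, map_sub, hP.idem, sub_self, add_zero, map_zero] at h1
      have h2 := hTinj _ h1
      rw [h2, map_zero, zero_add, sub_zero] at hx
      exact hx
    · intro y
      have hy : P y ∈ A.domain.map (P : X →ₗ[ℂ] X) := by rw [hP.map_domain]; exact ⟨y, rfl⟩
      obtain ⟨d, hd, hdy⟩ := hy
      have hdy : P d = P y := hdy
      obtain ⟨h1, h2⟩ := hP.commutes ⟨d, hd⟩
      dsimp only at h1 h2
      refine ⟨P (z • d - A ⟨d, hd⟩) + (y - P y), ?_⟩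
      rw [hap]
      have h3 : P (P (z • d - A ⟨d, hd⟩) + (y - P y)) = P (z • d - A ⟨d, hd⟩) := by
        rw [map_add, hP.idem, map_sub P y, hP.idem, sub_self, add_zero]
      rw [h3]
      have h4 := hT.2 ⟨P d, h1⟩
      dsimp only at h4
      rw [h2, ← map_smul, ← map_sub, hdy] at h4
      rw [h4]; abel
  · by_cases hw : z - ν⁻¹ ∈ σ
    · right
      have hmem : z - ν⁻¹ ∈ resolventSet
          (part A (LinearMap.range ((1 - P : X →L[ℂ] X) : X →ₗ[ℂ] X))) := by
        by_contra hn
        have : z - ν⁻¹ ∈ spectrum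
          (part A (LinearMap.range ((1 - P : X →L[ℂ] X) : X →ₗ[ℂ] X))) := hn
        rw [hP.spectrum_compl] at this
        exact this.2 hw
      have := isUnit_of_mem_resolventSet_part hT (P := 1 - P)
        (by simp [mul_sub, sub_mul, hidem]) (fun x => ?_) hν hmem
      · simpa using this
      · obtain ⟨h1, h2⟩ := hP.commutes x
        refine ⟨A.domain.sub_mem x.2 h1, ?_⟩
        have := A.map_sub x ⟨P x, h1⟩
        rw [h2] at this
        exact this
    · left
      refine isUnit_of_mem_resolventSet_part hT hidem hP.commutes hν ?_
      by_contra hn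
      have : z - ν⁻¹ ∈ spectrum (part A (LinearMap.range (P : X →ₗ[ℂ] X))) := hn
      rw [hP.spectrum_part] at this
      exact hw this

/-- A solution of the commutator equation for the resolvent `T = (z - A)⁻¹` maps `D(A)` into itself
and solves `B A - A B = K` there: evaluate at `v = T x`. -/
theorem IsResolventAt.commutator {z : ℂ} {T B K : X →L[ℂ] X} (hT : IsResolventAt A z T)
    (h : B * T - T * B = T * K * T) (v : A.domain) :
    ∃ hv : B v ∈ A.domain, B (A v) - A ⟨B v, hv⟩ = K v := by
  set x := z • (v : X) - A v with hx
  have hv : T x = v := hT.2 v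
  have h1 : B (T x) - T (B x) = T (K (T x)) := DFunLike.congr_fun h x
  have h2 : B v = T (B x + K v) := by
    rw [map_add, ← hv, ← h1]; abel
  obtain ⟨h3, h4⟩ := hT.1 (B x + K v)
  have h5 : B v ∈ A.domain := by rw [h2]; exact h3
  have h6 : A ⟨B v, h5⟩ = A ⟨T (B x + K v), h3⟩ := by congr 1; exact Subtype.ext h2
  refine ⟨h5, ?_⟩
  have h7 : A v = z • (v : X) - x := by rw [hx]; abel
  have h8 : A ⟨T (B x + K v), h3⟩ = z • B v - (B x + K v) :=
    (eq_sub_of_add_eq ((add_comm _ _).trans (sub_eq_iff_eq_add.1 h4).symm)).trans (by rw [h2])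
  rw [h6, h8, h7, map_sub, map_smul]; abel

end Resolvent

variable {X : Type*} [NormedAddCommGroup X] [NormedSpace ℂ X]

/-! ### Local solution of the commutator equation -/

section LocalSolution

theorem Cycle.ran_nonempty_of_index_ne_zero {γ : Cycle} {z : ℂ} (h : γ.index z ≠ 0) :
    γ.ran.Nonempty := by
  cases γ with
  | nil => exact absurd (by simp [Cycle.index]) h
  | cons p γ => exact ⟨p.toFun 0, p, List.mem_cons_self, 0, by simp, rfl⟩

theorem BoundedLipschitzOn.blockSylvester {𝔄 : Type*} [NormedRing 𝔄] [NormedAlgebra ℂ 𝔄]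
    {p T : ℝ → 𝔄} {J : Set ℝ} (hp : BoundedLipschitzOn p J) (hT : BoundedLipschitzOn T J) :
    BoundedLipschitzOn (fun t => blockSylvester (p t) (T t)) J := by
  have hl : ∀ f : ℝ → 𝔄, BoundedLipschitzOn f J →
      BoundedLipschitzOn (fun t => ContinuousLinearMap.mul ℂ 𝔄 (f t)) J :=
    fun f hf => (BoundedLipschitzOn.const (ContinuousLinearMap.mul ℂ 𝔄)).clm_apply hf
  have hr : ∀ f : ℝ → 𝔄, BoundedLipschitzOn f J →
      BoundedLipschitzOn (fun t => (ContinuousLinearMap.mul ℂ 𝔄).flip (f t)) J :=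
    fun f hf => (BoundedLipschitzOn.const (ContinuousLinearMap.mul ℂ 𝔄).flip).clm_apply hf
  have hq : BoundedLipschitzOn (fun t => 1 - p t) J := (BoundedLipschitzOn.const 1).sub hp
  exact (((((hl _ hp).mul ((hr _ hT).sub (hl _ hT))).mul (hr _ hq)).add
    (((hl _ hq).mul ((hr _ hT).sub (hl _ hT))).mul (hr _ hp))).add
      ((hl _ hp).mul (hr _ hp))).add ((hl _ hq).mul (hr _ hq))

/-- Near a point away from the exceptional set the equation `B A - A B = [P', P]` has a solution that
is bounded and Lipschitz in norm. The contour serves only to provide one common point `z` of the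
resolvent sets at which the resolvent is Lipschitz in time. -/
theorem SpectralGapCondition.exists_commutator_solution [CompleteSpace X] {m : ℕ∞}
    {A : ℝ → X →ₗ.[ℂ] X} {σ : ℝ → Set ℂ} {P : ℝ → X →L[ℂ] X} {U : ℝ → ℝ → ℝ → X →L[ℂ] X}
    (hcond : SpectralGapCondition m A σ P U) {t₀ : ℝ} (ht₀ : t₀ ∈ I)
    (hN : ∀ᶠ s in 𝓝[I] t₀, s ∉ fallSet σ fun t => spectrum (A t) \ σ t) :
    ∃ δ > 0, ∃ B : ℝ → X →L[ℂ] X, BoundedLipschitzOn B (I ∩ Metric.ball t₀ δ) ∧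
      ∀ s ∈ I ∩ Metric.ball t₀ δ, ∀ v : (A s).domain,
        ∃ hv : B s v ∈ (A s).domain, B s (A s v) - A s ⟨B s v, hv⟩ = commP P s v := by
  have hm : t₀ ∈ I \ fallSet σ fun t => spectrum (A t) \ σ t := ⟨ht₀, hN.self_of_nhdsWithin ht₀⟩
  obtain ⟨a, b, hab, -, htab, hJ, γ, hγ⟩ := hcond.contours t₀ hm
  have hassoc := hcond.associated
  obtain ⟨w, hw⟩ := (hassoc t₀ hm).nonempty
  obtain ⟨z, hz⟩ := Cycle.ran_nonempty_of_index_ne_zero (γ := γ) (z := w)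
    (by rw [hγ.index_one t₀ htab w hw]; exact one_ne_zero)
  obtain ⟨δ₁, hδ₁, hball⟩ := Metric.mem_nhdsWithin_iff.1 (hN.and hJ)
  rw [inter_comm] at hball
  set J := I ∩ Metric.ball t₀ δ₁ with hJdef
  have hres : ∀ s ∈ J, IsResolventAt (A s) z (resolvent (A s) z) := fun s hs =>
    isResolventAt_resolvent (hγ.ran_subset s (hball hs).2 hz)
  have hassoc' : ∀ s ∈ J, IsAssociatedProjection (A s) (σ s) (P s) := fun s hs =>
    hassoc s ⟨hs.1, (hball hs).1⟩
  have hTlip : BoundedLipschitzOn (fun s => resolvent (A s) z) J :=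
    (boundedLipschitzOn_of_contDiffOn hab (hγ.contDiff z hz)).mono fun s hs => (hball hs).2
  have hPlip : BoundedLipschitzOn P J :=
    (boundedLipschitzOn_of_contDiffOn zero_lt_one
      fun x => (hcond.regular x).of_le one_le_two).mono inter_subset_left
  have hKlip : BoundedLipschitzOn (commP P) J :=
    (boundedLipschitzOn_commP hcond.regular).mono inter_subset_left
  have ht₀J : t₀ ∈ J := ⟨ht₀, Metric.mem_ball_self hδ₁⟩
  have hidem : ∀ s ∈ J, P s * P s = P s := fun s hs => by ext x; exact (hassoc' s hs).idem x
  have hcomm : ∀ s ∈ J, P s * resolvent (A s) z = resolvent (A s) z * P s := fun s hs =>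
    (hres s hs).comm (hassoc' s hs).commutes
  have hunit : IsUnit (blockSylvester (P t₀) (resolvent (A t₀) z)) :=
    isUnit_blockSylvester (hidem t₀ ht₀J) (hcomm t₀ ht₀J)
      ((hassoc' t₀ ht₀J).isUnit_or (hres t₀ ht₀J))
  have hΨ : BoundedLipschitzOn (fun s => blockSylvester (P s) (resolvent (A s) z)) J :=
    hPlip.blockSylvester hTlip
  obtain ⟨δ₂, hδ₂, hu, hinv⟩ :=
    BoundedLipschitzOn.inverse (R := (X →L[ℂ] X) →L[ℂ] (X →L[ℂ] X)) hΨ ht₀J hunit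
  have hsub : I ∩ Metric.ball t₀ (min δ₁ δ₂) ⊆ J ∩ Metric.ball t₀ δ₂ := fun s hs =>
    ⟨⟨hs.1, Metric.ball_subset_ball (min_le_left _ _) hs.2⟩,
      Metric.ball_subset_ball (min_le_right _ _) hs.2⟩
  refine ⟨min δ₁ δ₂, lt_min hδ₁ hδ₂, fun s =>
    Ring.inverse (blockSylvester (P s) (resolvent (A s) z))
      (resolvent (A s) z * commP P s * resolvent (A s) z), ?_, fun s hs v => ?_⟩
  · exact (hinv.clm_apply (((hTlip.mul hKlip).mul hTlip).mono inter_subset_left)).mono hsub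
  · have hs' := hsub hs
    have hid := hidem s hs'.1
    have hqp : (1 - P s) * P s = 0 := by rw [sub_mul, hid, one_mul, sub_self]
    have hpq : P s * (1 - P s) = 0 := by rw [mul_sub, hid, mul_one, sub_self]
    have hK : commP P s = strongDeriv P I s * P s - P s * strongDeriv P I s := rfl
    refine (hres s hs'.1).commutator (commutator_equation_of_blockSylvester hid
      (hcomm s hs'.1) ?_ ?_ ?_) v
    · rw [hK, mul_sub, sub_mul, mul_assoc (P s) (_ * _), mul_assoc _ (P s) (P s), hid,
        ← mul_assoc (P s) (P s), hid, ← mul_assoc, sub_self]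
    · have e : (1 - P s) * commP P s * (1 - P s) = (1 - P s) * strongDeriv P I s *
          (P s * (1 - P s)) - ((1 - P s) * P s) * (strongDeriv P I s * (1 - P s)) := by
        rw [hK]; noncomm_ring
      rw [e, hpq, hqp, mul_zero, zero_mul, sub_zero]
    · have := Ring.mul_inverse_cancel _ (hu s hs')
      exact DFunLike.congr_fun this (resolvent (A s) z * commP P s * resolvent (A s) z)

end LocalSolution

/-! ### Comparison of evolution systems -/

section Evolution

theorem continuousOn_clm_apply_of_strong {F : ℝ → X →L[ℂ] X} {y : ℝ → X} {J : Set ℝ} {M : ℝ}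
    (hF : ∀ x, ContinuousOn (fun t => F t x) J) (hM : ∀ t ∈ J, ‖F t‖ ≤ M)
    (hy : ContinuousOn y J) : ContinuousOn (fun t => F t (y t)) J := by
  intro t ht
  have h1 : Tendsto (fun s => F s (y t)) (𝓝[J] t) (𝓝 (F t (y t))) := hF (y t) t ht
  have h2 : Tendsto (fun s => F s (y s - y t)) (𝓝[J] t) (𝓝 0) := by
    have h3 : Tendsto (fun s => M * ‖y s - y t‖) (𝓝[J] t) (𝓝 0) := by
      have : Tendsto (fun s => y s - y t) (𝓝[J] t) (𝓝 (y t - y t)) :=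
        (hy t ht).tendsto.sub tendsto_const_nhds
      rw [sub_self] at this
      simpa using this.norm.const_mul M
    refine squeeze_zero_norm' ?_ h3
    filter_upwards [self_mem_nhdsWithin] with s hs
    exact (F s).le_of_opNorm_le (hM s hs) _
  have := h2.add h1
  rw [zero_add] at this
  exact this.congr fun s => by rw [map_sub, sub_add_cancel]

variable {G : ℝ → X →ₗ.[ℂ] X} {U V : ℝ → ℝ → X →L[ℂ] X} {M : ℝ}

/-- At `t = 1`, where no initial condition is imposed, this follows from strong continuity. -/
theorem IsEvolutionSystem.self_eq_one (hU : IsEvolutionSystem G U)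
    (hd : ∀ t ∈ I, Dense ((G t).domain : Set X)) {t : ℝ} (ht : t ∈ I) : U t t = 1 := by
  have h1 : ∀ s ∈ Ico (0 : ℝ) 1, U s s = 1 := fun s hs => by
    apply DFunLike.coe_injective
    exact Continuous.ext_on (hd s ⟨hs.1, hs.2.le⟩) (U s s).continuous continuous_id
      fun y hy => hU.initial s hs y hy
  rcases ht.2.lt_or_eq with h | rfl
  · exact h1 t ⟨ht.1, h⟩
  · ext x
    have hc : ContinuousOn (fun s : ℝ => U s s x) I :=
      (hU.continuous x).comp (f := fun s : ℝ => (s, s)) (by fun_prop)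
        fun s hs => ⟨hs, hs, le_rfl⟩
    have h2 : Tendsto (fun s : ℝ => U s s x) (𝓝[Ico 0 1] 1) (𝓝 (U 1 1 x)) :=
      (hc 1 ht).mono_left (nhdsWithin_mono _ Ico_subset_Icc_self)
    have : (𝓝[Ico (0 : ℝ) 1] 1).NeBot := by
      rw [← mem_closure_iff_nhdsWithin_neBot, closure_Ico zero_ne_one]; exact ht
    refine tendsto_nhds_unique h2 (tendsto_const_nhds.congr' ?_)
    filter_upwards [self_mem_nhdsWithin] with s hs
    rw [h1 s hs]

theorem _root_.HasDerivWithinAt.eventually_norm_sub_le {E : Type*} [NormedAddCommGroup E]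
    [NormedSpace ℝ E] {f : ℝ → E} {f' : E} {t : ℝ} (h : HasDerivWithinAt f f' (Icc t 1) t)
    (ht : t < 1) {η : ℝ} (hη : 0 < η) :
    ∀ᶠ s in 𝓝[>] t, ‖f s - f t - (s - t) • f'‖ ≤ η * (s - t) := by
  have h1 := (hasDerivWithinAt_iff_isLittleO.1 h).def hη
  have h2 : 𝓝[>] t ≤ 𝓝[Icc t 1] t := by
    rw [← nhdsWithin_Ioc_eq_nhdsGT ht]
    exact nhdsWithin_mono _ Ioc_subset_Icc_self
  filter_upwards [h2 h1, self_mem_nhdsWithin] with s hs hs'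
  rwa [Real.norm_of_nonneg (sub_nonneg.2 (le_of_lt hs'))] at hs

/-- If `y` solves `y' = G y` up to an error of rate `c`, then it stays close to the orbit of `U`. The
error is stated with difference quotients, so that `y` need not be differentiable; the proof
bounds the right slopes of `τ ↦ U(b,τ) y(τ)`. -/
theorem IsEvolutionSystem.norm_sub_apply_le (hU : IsEvolutionSystem G U)
    (hd : ∀ t ∈ I, Dense ((G t).domain : Set X)) (hM0 : 0 < M)
    (hM : ∀ s t : ℝ, (s, t) ∈ Δ → ‖U t s‖ ≤ M) {a b : ℝ} (ha : 0 ≤ a) (hab : a ≤ b) (hb : b ≤ 1)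
    {y : ℝ → X} (hyc : ContinuousOn y (Icc a b)) {c β β' : ℝ → ℝ}
    (hy : ∀ τ ∈ Ico a b, ∃ h : y τ ∈ (G τ).domain, ∀ r > c τ, ∀ᶠ s in 𝓝[>] τ,
      ‖y s - y τ - (s - τ) • G τ ⟨y τ, h⟩‖ ≤ r * (s - τ))
    (hβ : ∀ τ, HasDerivAt β (β' τ) τ) (hc : ∀ τ ∈ Ico a b, M * c τ ≤ β' τ) :
    ‖y b - U b a (y a)‖ ≤ β b - β a := by
  have hgc : ContinuousOn (fun τ => U b τ (y τ)) (Icc a b) := by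
    have hmem : ∀ τ ∈ Icc a b, (τ, b) ∈ Δ := fun τ hτ =>
      ⟨⟨ha.trans hτ.1, hτ.2.trans hb⟩, ⟨ha.trans hab, hb⟩, hτ.2⟩
    refine continuousOn_clm_apply_of_strong (M := M) (fun x => ?_) (fun τ hτ => hM _ _ (hmem τ hτ))
      hyc
    exact (hU.continuous x).comp (f := fun s : ℝ => (s, b)) (by fun_prop) hmem
  have hmain := image_le_of_liminf_slope_right_le_deriv_boundary
    (f := fun τ => ‖U b τ (y τ) - U b a (y a)‖) (B := fun τ => β τ - β a) (B' := β')
    (a := a) (b := b) (hgc.sub continuousOn_const).norm (by simp)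
    (fun τ _ => ((hβ τ).sub_const _).continuousAt.continuousWithinAt)
    (fun τ _ => ((hβ τ).sub_const _).hasDerivWithinAt) ?_ (right_mem_Icc.2 hab)
  · simpa [hU.self_eq_one hd ⟨ha.trans hab, hb⟩] using hmain
  intro τ hτ r hr
  obtain ⟨h, hτy⟩ := hy τ hτ
  have hτ1 : τ < 1 := hτ.2.trans_le hb
  have hτ0 : 0 ≤ τ := ha.trans hτ.1
  -- with this `η` the slope bound `M * (c τ + 2 * η)` stays below `r`
  set η := (r - β' τ) / (4 * M) with hη
  have hη0 : 0 < η := div_pos (sub_pos.2 hr) (by positivity)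
  have hη4 : 4 * M * η = r - β' τ := by rw [hη]; field_simp
  obtain ⟨h', hder⟩ := hU.solves τ ⟨hτ0, hτ1⟩ (y τ) h τ ⟨le_rfl, hτ1.le⟩
  have hUτ : U τ τ (y τ) = y τ := hU.initial τ ⟨hτ0, hτ1⟩ _ h
  have hG : G τ ⟨U τ τ (y τ), h'⟩ = G τ ⟨y τ, h⟩ := by congr 1; exact Subtype.ext hUτ
  rw [hG] at hder
  refine Eventually.frequently ?_
  filter_upwards [hτy (c τ + η) (by linarith), hder.eventually_norm_sub_le hτ1 hη0,
    Ioo_mem_nhdsGT hτ.2] with s h1 h2 hs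
  rw [hUτ] at h2
  have hsτ : 0 < s - τ := sub_pos.2 hs.1
  have hs1 : s ≤ 1 := (hs.2.trans_le hb).le
  have hcoc : U b τ (y τ) = U b s (U s τ (y τ)) := by
    rw [← hU.cocycle τ s b ⟨⟨hτ0, hτ1.le⟩, ⟨hτ0.trans hs.1.le, hs1⟩, hs.1.le⟩
      ⟨⟨hτ0.trans hs.1.le, hs1⟩, ⟨ha.trans hab, hb⟩, hs.2.le⟩]
    rfl
  have e : U b s (y s) - U b τ (y τ) = U b s ((y s - y τ - (s - τ) • G τ ⟨y τ, h⟩)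
      - (U s τ (y τ) - y τ - (s - τ) • G τ ⟨y τ, h⟩)) := by
    rw [hcoc, ← map_sub]; congr 1; abel
  have h3 : ‖U b s (y s) - U b τ (y τ)‖ ≤ M * ((c τ + η) * (s - τ) + η * (s - τ)) := by
    rw [e]
    refine ((U b s).le_of_opNorm_le
      (hM s b ⟨⟨hτ0.trans hs.1.le, hs1⟩, ⟨ha.trans hab, hb⟩, hs.2.le⟩) _).trans ?_
    gcongr
    exact (norm_sub_le _ _).trans (add_le_add h1 h2)
  rw [slope_def_field, div_lt_iff₀ hsτ]
  have h4 := norm_sub_norm_le (U b s (y s) - U b a (y a)) (U b τ (y τ) - U b a (y a))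
  rw [sub_sub_sub_cancel_right] at h4
  have h5 : M * ((c τ + η) * (s - τ) + η * (s - τ)) = (M * c τ + 2 * M * η) * (s - τ) := by ring
  have h6 : M * c τ + 2 * M * η < r := by
    have := hc τ hτ
    linarith
  calc _ ≤ _ := h4
    _ ≤ _ := h3
    _ = _ := h5
    _ < _ := mul_lt_mul_of_pos_right h6 hsτ

variable {K : ℝ → X →L[ℂ] X} {k : ℝ}

theorem IsEvolutionSystem.exists_hasDerivWithinAt
    (hV : IsEvolutionSystem (fun t => (K t : X →ₗ[ℂ] X) +ᵥ G t) V)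
    {x : X} (hx : x ∈ (G 0).domain) {τ : ℝ} (hτ : τ ∈ Ico (0 : ℝ) 1) :
    ∃ h : V τ 0 x ∈ (G τ).domain,
      HasDerivWithinAt (fun s => V s 0 x) (K τ (V τ 0 x) + G τ ⟨V τ 0 x, h⟩) (Icc τ 1) τ := by
  obtain ⟨h, hd⟩ := hV.solves 0 ⟨le_rfl, zero_lt_one⟩ x hx τ ⟨hτ.1, hτ.2.le⟩
  exact ⟨h, hd.mono (Icc_subset_Icc_left hτ.1)⟩

theorem IsEvolutionSystem.continuousOn_apply_zero (hV : IsEvolutionSystem G V) (x : X) :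
    ContinuousOn (fun s => V s 0 x) I :=
  (hV.continuous x).comp (f := fun s : ℝ => ((0 : ℝ), s)) (by fun_prop)
    fun s hs => ⟨⟨le_rfl, zero_le_one⟩, hs, hs.1⟩

theorem norm_le_of_dense {L : X →L[ℂ] X} {s : Set X} (hs : Dense s) {C : ℝ} (hC : 0 ≤ C)
    (h : ∀ x ∈ s, ‖L x‖ ≤ C * ‖x‖) : ‖L‖ ≤ C := by
  refine L.opNorm_le_bound hC fun x => ?_
  have hcl : IsClosed {x | ‖L x‖ ≤ C * ‖x‖} := isClosed_le (by fun_prop) (by fun_prop)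
  exact hcl.closure_subset_iff.2 h (hs x)

/-- The bound for `y(τ) = V(τ,0) x`, with error rate `‖K(τ) y(τ)‖`. -/
theorem IsEvolutionSystem.norm_sub_apply_le_of_perturbation (hU : IsEvolutionSystem G U)
    (hV : IsEvolutionSystem (fun t => (K t : X →ₗ[ℂ] X) +ᵥ G t) V)
    (hd : ∀ t ∈ I, Dense ((G t).domain : Set X)) (hM0 : 0 < M)
    (hM : ∀ s t : ℝ, (s, t) ∈ Δ → ‖U t s‖ ≤ M) (hk : ∀ t ∈ I, ‖K t‖ ≤ k)
    {a b : ℝ} (ha : 0 ≤ a) (hab : a ≤ b) (hb : b ≤ 1) {x : X} (hx : x ∈ (G 0).domain)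
    {β β' : ℝ → ℝ} (hβ : ∀ τ, HasDerivAt β (β' τ) τ)
    (hc : ∀ τ ∈ Ico a b, M * (k * ‖V τ 0 x‖) ≤ β' τ) :
    ‖V b 0 x - U b a (V a 0 x)‖ ≤ β b - β a := by
  refine hU.norm_sub_apply_le hd hM0 hM ha hab hb (y := fun s => V s 0 x)
    (c := fun τ => k * ‖V τ 0 x‖)
    ((hV.continuousOn_apply_zero x).mono (Icc_subset_Icc ha hb)) (fun τ hτ => ?_) hβ hc
  have hτ1 : τ < 1 := hτ.2.trans_le hb
  have hτ0 : 0 ≤ τ := ha.trans hτ.1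
  obtain ⟨h, hder⟩ := hV.exists_hasDerivWithinAt hx ⟨hτ0, hτ1⟩
  refine ⟨h, fun r hr => ?_⟩
  filter_upwards [hder.eventually_norm_sub_le hτ1 (sub_pos.2 hr), self_mem_nhdsWithin] with s h1 hs
  have hsτ : 0 ≤ s - τ := sub_nonneg.2 (le_of_lt hs)
  have e : V s 0 x - V τ 0 x - (s - τ) • G τ ⟨V τ 0 x, h⟩ =
      (V s 0 x - V τ 0 x - (s - τ) • (K τ (V τ 0 x) + G τ ⟨V τ 0 x, h⟩))
        + (s - τ) • K τ (V τ 0 x) := by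
    rw [smul_add]; abel
  have h2 : ‖(s - τ) • K τ (V τ 0 x)‖ ≤ (s - τ) * (k * ‖V τ 0 x‖) := by
    rw [norm_smul, Real.norm_of_nonneg hsτ]
    gcongr
    exact (K τ).le_of_opNorm_le (hk τ ⟨hτ0, hτ1.le⟩) _
  rw [e]
  refine (norm_add_le _ _).trans ((add_le_add h1 h2).trans_eq ?_)
  ring

/-- A Gronwall bound, independent of `G`: the maximum of `e^{-λτ} ‖V(τ,0) x‖` is absorbed into the
perturbation bound for `λ = 2 M k + 1`. -/
theorem IsEvolutionSystem.norm_le_of_perturbation (hU : IsEvolutionSystem G U)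
    (hV : IsEvolutionSystem (fun t => (K t : X →ₗ[ℂ] X) +ᵥ G t) V)
    (hd : ∀ t ∈ I, Dense ((G t).domain : Set X)) (hM0 : 0 < M)
    (hM : ∀ s t : ℝ, (s, t) ∈ Δ → ‖U t s‖ ≤ M) (hk : ∀ t ∈ I, ‖K t‖ ≤ k) :
    ∀ t ∈ I, ‖V t 0‖ ≤ 2 * M * Real.exp (2 * M * k + 1) := by
  have hk0 : 0 ≤ k := (norm_nonneg _).trans (hk 0 ⟨le_rfl, zero_le_one⟩)
  have h0I : (0 : ℝ) ∈ I := ⟨le_rfl, zero_le_one⟩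
  set lam := 2 * M * k + 1 with hlam
  have hlam0 : 0 < lam := by positivity
  intro t ht
  refine norm_le_of_dense (hd 0 h0I) (by positivity) fun x hx => ?_
  obtain ⟨b, hbI, hbmax⟩ := isCompact_Icc.exists_isMaxOn ⟨0, h0I⟩
    (f := fun s => Real.exp (-(lam * s)) * ‖V s 0 x‖)
    (ContinuousOn.mul (by fun_prop) (hV.continuousOn_apply_zero x).norm)
  set S := Real.exp (-(lam * b)) * ‖V b 0 x‖ with hS
  have hS0 : 0 ≤ S := by positivity
  have hle : ∀ s ∈ I, ‖V s 0 x‖ ≤ S * Real.exp (lam * s) := fun s hs => by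
    have h1 : Real.exp (-(lam * s)) * ‖V s 0 x‖ ≤ S := hbmax hs
    rw [Real.exp_neg, inv_mul_le_iff₀ (Real.exp_pos _)] at h1
    linarith
  have hest := hU.norm_sub_apply_le_of_perturbation hV hd hM0 hM hk le_rfl hbI.1 hbI.2 hx
    (β := fun s => M * k * S / lam * Real.exp (lam * s))
    (β' := fun s => M * k * S * Real.exp (lam * s)) (fun τ => by
      have h1 : HasDerivAt (fun s : ℝ => lam * s) lam τ := by
        simpa using (hasDerivAt_id τ).const_mul lam
      have h2 := h1.exp.const_mul (M * k * S / lam)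
      exact h2.congr_deriv (by field_simp)) (fun τ hτ => by
      have := hle τ ⟨hτ.1, hτ.2.le.trans hbI.2⟩
      calc M * (k * ‖V τ 0 x‖) ≤ M * (k * (S * Real.exp (lam * τ))) := by gcongr
        _ = _ := by ring)
  have hV0 : V 0 0 x = x := hV.initial 0 ⟨le_rfl, zero_lt_one⟩ x hx
  rw [hV0] at hest
  have hUx : ‖U b 0 x‖ ≤ M * ‖x‖ := (U b 0).le_of_opNorm_le (hM 0 b ⟨h0I, hbI, hbI.1⟩) _
  have h3 : ‖V b 0 x‖ ≤ M * ‖x‖ + M * k * S / lam * Real.exp (lam * b) := by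
    have e : ‖V b 0 x‖ ≤ ‖V b 0 x - U b 0 x‖ + ‖U b 0 x‖ := norm_le_norm_sub_add _ _
    have : 0 ≤ M * k * S / lam * Real.exp (lam * 0) := by positivity
    linarith
  have hfrac : M * k * S / lam ≤ S / 2 := by
    rw [div_le_div_iff₀ hlam0 two_pos, hlam]
    nlinarith
  have hexp : Real.exp (-(lam * b)) ≤ 1 := Real.exp_le_one_iff.2 (by
    have := mul_nonneg hlam0.le hbI.1
    linarith)
  have h4 : S ≤ M * ‖x‖ + S / 2 := by
    calc S ≤ Real.exp (-(lam * b)) * (M * ‖x‖ + M * k * S / lam * Real.exp (lam * b)) := by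
          rw [hS]; gcongr
      _ = Real.exp (-(lam * b)) * (M * ‖x‖) + M * k * S / lam := by
          rw [mul_add, mul_left_comm _ (M * k * S / lam), ← Real.exp_add, neg_add_cancel,
            Real.exp_zero, mul_one]
      _ ≤ 1 * (M * ‖x‖) + S / 2 := by gcongr
      _ = _ := by ring
  calc ‖V t 0 x‖ ≤ S * Real.exp (lam * t) := hle t ht
    _ ≤ (2 * M * ‖x‖) * Real.exp (lam * 1) := by
        gcongr
        · linarith
        · exact ht.2
    _ = _ := by rw [mul_one]; ring

theorem IsEvolutionSystem.norm_sub_comp_le (hU : IsEvolutionSystem G U)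
    (hV : IsEvolutionSystem (fun t => (K t : X →ₗ[ℂ] X) +ᵥ G t) V)
    (hd : ∀ t ∈ I, Dense ((G t).domain : Set X)) (hM0 : 0 < M)
    (hM : ∀ s t : ℝ, (s, t) ∈ Δ → ‖U t s‖ ≤ M) (hk : ∀ t ∈ I, ‖K t‖ ≤ k) {S : ℝ}
    (hS : ∀ t ∈ I, ‖V t 0‖ ≤ S) {a b : ℝ} (ha : 0 ≤ a) (hab : a ≤ b) (hb : b ≤ 1) :
    ‖V b 0 - U b a * V a 0‖ ≤ M * k * S * (b - a) := by
  have h0I : (0 : ℝ) ∈ I := ⟨le_rfl, zero_le_one⟩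
  have hk0 : 0 ≤ k := (norm_nonneg _).trans (hk 0 h0I)
  have hS0 : 0 ≤ S := (norm_nonneg _).trans (hS 0 h0I)
  refine norm_le_of_dense (hd 0 h0I) (mul_nonneg (by positivity) (sub_nonneg.2 hab)) fun x hx => ?_
  have := hU.norm_sub_apply_le_of_perturbation hV hd hM0 hM hk ha hab hb hx
    (β := fun s => M * k * S * ‖x‖ * s) (β' := fun s => M * k * S * ‖x‖)
    (fun τ => by simpa using (hasDerivAt_id τ).const_mul (M * k * S * ‖x‖)) (fun τ hτ => by
      have := (V τ 0).le_of_opNorm_le (hS τ ⟨ha.trans hτ.1, hτ.2.le.trans hb⟩) x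
      calc M * (k * ‖V τ 0 x‖) ≤ M * (k * (S * ‖x‖)) := by gcongr
        _ = _ := by ring)
  refine this.trans_eq ?_
  ring

/-- If the perturbation is a commutator, `K = W G - G W`, then `(1 - W) V(·,0) x` solves `y' = G y` up
to an error of the size of `W` and its Lipschitz constant, as the terms of order `G` cancel. -/
theorem IsEvolutionSystem.norm_sub_comp_le_of_commutator (hU : IsEvolutionSystem G U)
    (hV : IsEvolutionSystem (fun t => (K t : X →ₗ[ℂ] X) +ᵥ G t) V)
    (hd : ∀ t ∈ I, Dense ((G t).domain : Set X)) (hM0 : 0 < M)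
    (hM : ∀ s t : ℝ, (s, t) ∈ Δ → ‖U t s‖ ≤ M) (hk : ∀ t ∈ I, ‖K t‖ ≤ k) {S : ℝ}
    (hS : ∀ t ∈ I, ‖V t 0‖ ≤ S) {a b : ℝ} (ha : 0 ≤ a) (hab : a ≤ b) (hb : b ≤ 1)
    {W : ℝ → X →L[ℂ] X} {w : ℝ} (hw0 : 0 ≤ w) (hw : ∀ t ∈ Icc a b, ‖W t‖ ≤ w)
    (hWlip : ∀ s ∈ Icc a b, ∀ t ∈ Icc a b, ‖W t - W s‖ ≤ w * |t - s|)
    (hcomm : ∀ s ∈ Icc a b, ∀ v : (G s).domain,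
      ∃ hv : W s v ∈ (G s).domain, W s (G s v) - G s ⟨W s v, hv⟩ = K s v) :
    ‖V b 0 - U b a * V a 0‖ ≤ (M * (1 + k) + 1 + M) * S * w := by
  have h0I : (0 : ℝ) ∈ I := ⟨le_rfl, zero_le_one⟩
  have hk0 : 0 ≤ k := (norm_nonneg _).trans (hk 0 h0I)
  have hS0 : 0 ≤ S := (norm_nonneg _).trans (hS 0 h0I)
  have hsub : Icc a b ⊆ I := Icc_subset_Icc ha hb
  refine norm_le_of_dense (hd 0 h0I) (by positivity) fun x hx => ?_
  set v : ℝ → X := fun s => V s 0 x with hv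
  have hvS : ∀ s ∈ I, ‖v s‖ ≤ S * ‖x‖ := fun s hs => (V s 0).le_of_opNorm_le (hS s hs) x
  have hvc : ContinuousOn v (Icc a b) := (hV.continuousOn_apply_zero x).mono hsub
  have hWc : ContinuousOn (fun s => W s (v s)) (Icc a b) := by
    have : ContinuousOn W (Icc a b) :=
      BoundedLipschitzOn.continuousOn ⟨w, hw0, hw, hWlip⟩
    exact this.clm_apply hvc
  set c : ℝ := w * (S * ‖x‖) * (1 + k) with hc
  have hest := hU.norm_sub_apply_le hd hM0 hM ha hab hb (y := fun s => v s - W s (v s))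
    (hvc.sub hWc) (c := fun _ => c) (β := fun s => M * c * s) (β' := fun _ => M * c) (fun τ hτ => ?_)
    (fun τ => by simpa using (hasDerivAt_id τ).const_mul (M * c)) (fun _ _ => le_rfl)
  · have h1 : M * c * b - M * c * a ≤ M * c := by
      have : 0 ≤ M * c := by positivity
      nlinarith
    have hWb : ‖W b (v b)‖ ≤ w * (S * ‖x‖) :=
      ((W b).le_of_opNorm_le (hw b (right_mem_Icc.2 hab)) _).trans
        (mul_le_mul_of_nonneg_left (hvS b (hsub (right_mem_Icc.2 hab))) hw0)
    have hWa : ‖W a (v a)‖ ≤ w * (S * ‖x‖) :=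
      ((W a).le_of_opNorm_le (hw a (left_mem_Icc.2 hab)) _).trans
        (mul_le_mul_of_nonneg_left (hvS a (hsub (left_mem_Icc.2 hab))) hw0)
    have hUWa : ‖U b a (W a (v a))‖ ≤ M * (w * (S * ‖x‖)) :=
      ((U b a).le_of_opNorm_le
        (hM a b ⟨hsub (left_mem_Icc.2 hab), hsub (right_mem_Icc.2 hab), hab⟩) _).trans
        (mul_le_mul_of_nonneg_left hWa hM0.le)
    have e : (V b 0 - U b a * V a 0) x = ((v b - W b (v b)) - U b a (v a - W a (v a)))
        + W b (v b) - U b a (W a (v a)) := by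
      rw [map_sub]
      change v b - U b a (v a) = _
      abel
    rw [e]
    have h2 := (norm_sub_le ((v b - W b (v b)) - U b a (v a - W a (v a)) + W b (v b))
      (U b a (W a (v a)))).trans (add_le_add_left (norm_add_le _ _) _)
    refine h2.trans ?_
    have : (M * (1 + k) + 1 + M) * S * w * ‖x‖ = M * c + w * (S * ‖x‖) + M * (w * (S * ‖x‖)) := by
      rw [hc]; ring
    rw [this]
    linarith
  have hτI : τ ∈ Icc a b := ⟨hτ.1, hτ.2.le⟩
  have hτ1 : τ < 1 := hτ.2.trans_le hb
  have hτ0 : 0 ≤ τ := ha.trans hτ.1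
  obtain ⟨h, hder⟩ := hV.exists_hasDerivWithinAt hx ⟨hτ0, hτ1⟩
  obtain ⟨h', hcm⟩ := hcomm τ hτI ⟨v τ, h⟩
  refine ⟨(G τ).domain.sub_mem h h', fun r hr => ?_⟩
  -- `W` is only Lipschitz, so its increment is estimated and not differentiated
  set η := (r - c) / (1 + w) with hη
  have hη0 : 0 < η := div_pos (sub_pos.2 hr) (by positivity)
  have hη1 : (1 + w) * η = r - c := by rw [hη]; field_simp
  have hGsub : G τ ⟨v τ - W τ (v τ), (G τ).domain.sub_mem h h'⟩ =
      G τ ⟨v τ, h⟩ - G τ ⟨W τ (v τ), h'⟩ := (G τ).map_sub ⟨v τ, h⟩ ⟨W τ (v τ), h'⟩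
  filter_upwards [hder.eventually_norm_sub_le hτ1 hη0, Ioo_mem_nhdsGT hτ.2] with s h1 hs
  have hsτ : 0 ≤ s - τ := sub_nonneg.2 hs.1.le
  have hsI : s ∈ Icc a b := ⟨hτ.1.trans hs.1.le, hs.2.le⟩
  set q := v s - v τ - (s - τ) • (K τ (v τ) + G τ ⟨v τ, h⟩) with hq
  have hcm' : K τ (v τ) = W τ (G τ ⟨v τ, h⟩) - G τ ⟨W τ (v τ), h'⟩ := hcm.symm
  have e : v s - W s (v s) - (v τ - W τ (v τ)) - (s - τ) •
      G τ ⟨v τ - W τ (v τ), (G τ).domain.sub_mem h h'⟩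
      = q - W τ q - (W s - W τ) (v s) - (s - τ) • W τ (K τ (v τ)) := by
    have hWq : W τ q = W τ (v s) - W τ (v τ)
        - (s - τ) • (W τ (K τ (v τ)) + W τ (G τ ⟨v τ, h⟩)) := by
      rw [hq, map_sub, map_sub, ← Complex.coe_smul, map_smul, map_add, Complex.coe_smul]
    have hG2 : G τ ⟨W τ (v τ), h'⟩ = W τ (G τ ⟨v τ, h⟩) - K τ (v τ) := by rw [hcm']; abel
    rw [hWq, hGsub, hG2, hq, sub_apply]
    simp only [smul_add, smul_sub]
    abel
  have b1 : ‖W τ q‖ ≤ w * (η * (s - τ)) :=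
    ((W τ).le_of_opNorm_le (hw τ hτI) _).trans (mul_le_mul_of_nonneg_left h1 hw0)
  have b2 : ‖(W s - W τ) (v s)‖ ≤ w * (s - τ) * (S * ‖x‖) := by
    have h3 := hWlip τ hτI s hsI
    rw [abs_of_nonneg hsτ] at h3
    exact ((W s - W τ).le_of_opNorm_le h3 _).trans
      (mul_le_mul_of_nonneg_left (hvS s (hsub hsI)) (by positivity))
  have b3 : ‖(s - τ) • W τ (K τ (v τ))‖ ≤ (s - τ) * (w * (k * (S * ‖x‖))) := by
    rw [norm_smul, Real.norm_of_nonneg hsτ]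
    refine mul_le_mul_of_nonneg_left (((W τ).le_of_opNorm_le (hw τ hτI) _).trans
      (mul_le_mul_of_nonneg_left (((K τ).le_of_opNorm_le (hk τ (hsub hτI)) _).trans
        (mul_le_mul_of_nonneg_left (hvS τ (hsub hτI)) hk0)) hw0)) hsτ
  rw [e]
  have h4 : ‖q - W τ q - (W s - W τ) (v s) - (s - τ) • W τ (K τ (v τ))‖
      ≤ ‖q‖ + ‖W τ q‖ + ‖(W s - W τ) (v s)‖ + ‖(s - τ) • W τ (K τ (v τ))‖ := by
    refine (norm_sub_le _ _).trans (add_le_add_left ?_ _)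
    refine (norm_sub_le _ _).trans (add_le_add_left ?_ _)
    exact norm_sub_le _ _
  have h5 : r * (s - τ) = η * (s - τ) + w * (η * (s - τ)) + w * (s - τ) * (S * ‖x‖)
      + (s - τ) * (w * (k * (S * ‖x‖))) := by
    have : r = (1 + w) * η + c := by rw [hη1]; ring
    rw [this, hc]; ring
  rw [h5]
  linarith

end Evolution

/-! ### Gluing estimates over the time interval -/

section Defect

/-- The property `Q` of intervals holds for all sufficiently small subintervals of `[0,1]`
around `t`. -/
def LocallyAt (Q : ℝ → ℝ → Prop) (t : ℝ) : Prop :=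
  ∃ δ > 0, ∀ a b : ℝ, 0 ≤ a → a ≤ b → b ≤ 1 → a ∈ Metric.ball t δ → b ∈ Metric.ball t δ → Q a b

/-- An additive property of intervals that holds locally holds globally, by compactness. -/
theorem interval_of_locallyAt {Q : ℝ → ℝ → Prop}
    (hadd : ∀ a b c, 0 ≤ a → a ≤ b → b ≤ c → c ≤ 1 → Q a b → Q b c → Q a c)
    {a b : ℝ} (ha : 0 ≤ a) (hab : a ≤ b) (hb : b ≤ 1) (h : ∀ t ∈ Icc a b, LocallyAt Q t) :
    Q a b := by
  choose! δ hδ hQ using h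
  obtain ⟨t, ht0, htm, ⟨n, hn⟩, ht⟩ := exists_monotone_Icc_subset_open_cover_Icc hab
    (c := fun i : Icc a b => {x : Icc a b | (x : ℝ) ∈ Metric.ball (i : ℝ) (δ i)})
    (fun i => Metric.isOpen_ball.preimage continuous_subtype_val)
    (fun x _ => mem_iUnion.2 ⟨x, Metric.mem_ball_self (hδ x x.2)⟩)
  have hstep : ∀ j, Q (t j) (t (j + 1)) := fun j => by
    obtain ⟨i, hi⟩ := ht j
    have hle : t j ≤ t (j + 1) := htm (Nat.le_succ j)
    exact hQ i i.2 _ _ (ha.trans (t j).2.1) hle ((t (j + 1)).2.2.trans hb)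
      (hi (left_mem_Icc.2 hle)) (hi (right_mem_Icc.2 hle))
  have hall : ∀ j, Q a (t (j + 1)) := fun j => by
    induction j with
    | zero =>
      have := hstep 0
      rwa [ht0] at this
    | succ j ih =>
      exact hadd _ _ _ ha (t (j + 1)).2.1 (htm (Nat.le_succ _)) ((t (j + 1 + 1)).2.2.trans hb) ih
        (hstep (j + 1))
  have := hall n
  rwa [hn (n + 1) (Nat.le_succ n)] at this

/-- `D ε a b` behaves like the error `‖V_ε(b,0) - U_ε(b,a) V_ε(a,0)‖` made on `[a,b]` by replacing
`V_ε` with `U_ε`: it is subadditive up to the stability constant `M`, and at most `C` times the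
length of the interval, uniformly in `ε`. -/
structure IsDefect (D : ℝ → ℝ → ℝ → ℝ) (M C : ℝ) : Prop where
  one_le : 1 ≤ M
  const_nonneg : 0 ≤ C
  add_le : ∀ ε > 0, ∀ a b c, 0 ≤ a → a ≤ b → b ≤ c → c ≤ 1 → D ε a c ≤ M * D ε a b + D ε b c
  le : ∀ ε > 0, ∀ a b, 0 ≤ a → a ≤ b → b ≤ 1 → D ε a b ≤ C * (b - a)

/-- The errors on subintervals of `[a,b]` are of order `ε`, uniformly. -/
def IsOrderOn (D : ℝ → ℝ → ℝ → ℝ) (a b : ℝ) : Prop :=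
  ∃ C, 0 ≤ C ∧ ∀ ε > 0, ∀ a' b', a ≤ a' → a' ≤ b' → b' ≤ b → D ε a' b' ≤ C * ε

/-- The errors on subintervals of `[a,b]` are at most `η` for all small `ε > 0`. -/
def EventuallyLeOn (D : ℝ → ℝ → ℝ → ℝ) (η a b : ℝ) : Prop :=
  ∀ᶠ ε in 𝓝[>] (0 : ℝ), ∀ a' b', a ≤ a' → a' ≤ b' → b' ≤ b → D ε a' b' ≤ η

/-- The errors on subintervals of `[a,b]` tend to `0` with `ε`, uniformly. -/
def IsSmallOn (D : ℝ → ℝ → ℝ → ℝ) (a b : ℝ) : Prop := ∀ η > 0, EventuallyLeOn D η a b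

variable {D : ℝ → ℝ → ℝ → ℝ} {M C : ℝ}

theorem IsOrderOn.isSmallOn {a b : ℝ} (h : IsOrderOn D a b) : IsSmallOn D a b := by
  obtain ⟨C, hC, h⟩ := h
  intro η hη
  have hpos : 0 < η / (C + 1) := by positivity
  filter_upwards [Ioo_mem_nhdsGT hpos] with ε hε a' b' h1 h2 h3
  refine (h ε hε.1 a' b' h1 h2 h3).trans ?_
  have := (lt_div_iff₀ (by positivity : 0 < C + 1)).1 hε.2
  have := hε.1
  nlinarith

theorem IsDefect.isOrderOn_add (hD : IsDefect D M C) (a b c : ℝ) (ha : 0 ≤ a) (_hab : a ≤ b)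
    (_hbc : b ≤ c) (hc : c ≤ 1) (h1 : IsOrderOn D a b) (h2 : IsOrderOn D b c) :
    IsOrderOn D a c := by
  obtain ⟨C₁, hC₁, h1⟩ := h1
  obtain ⟨C₂, hC₂, h2⟩ := h2
  have hM := hD.one_le
  refine ⟨M * C₁ + C₂, by positivity, fun ε hε a' c' haa hac hcc => ?_⟩
  have e1 : C₁ * ε ≤ M * (C₁ * ε) := le_mul_of_one_le_left (by positivity) hM
  have e2 : 0 ≤ C₂ * ε := by positivity
  have e3 : (M * C₁ + C₂) * ε = M * (C₁ * ε) + C₂ * ε := by ring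
  rw [e3]
  rcases le_total c' b with h | h
  · have := h1 ε hε a' c' haa hac h
    linarith
  rcases le_total b a' with h' | h'
  · have := h2 ε hε a' c' h' hac hcc
    have : 0 ≤ C₁ * ε := by positivity
    linarith
  have k1 := h1 ε hε a' b haa h' le_rfl
  have k2 := h2 ε hε b c' le_rfl h hcc
  have k3 := hD.add_le ε hε a' b c' (ha.trans haa) h' h (hcc.trans hc)
  have : M * D ε a' b ≤ M * (C₁ * ε) := by gcongr
  linarith

theorem IsDefect.eventuallyLeOn_add (hD : IsDefect D M C) {a b c η : ℝ} (hη : 0 ≤ η) (ha : 0 ≤ a)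
    (hc : c ≤ 1) (h1 : EventuallyLeOn D η a b) (h2 : EventuallyLeOn D η b c) :
    EventuallyLeOn D ((M + 1) * η) a c := by
  have hM := hD.one_le
  filter_upwards [h1, h2, self_mem_nhdsWithin] with ε h1 h2 hε a' c' haa hac hcc
  have e1 : η ≤ M * η := le_mul_of_one_le_left hη hM
  rcases le_total c' b with h | h
  · have := h1 a' c' haa hac h
    linarith
  rcases le_total b a' with h' | h'
  · have := h2 a' c' h' hac hcc
    linarith
  have k1 := h1 a' b haa h' le_rfl
  have k2 := h2 b c' le_rfl h hcc
  have k3 := hD.add_le ε hε a' b c' (ha.trans haa) h' h (hcc.trans hc)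
  have : M * D ε a' b ≤ M * η := by gcongr
  linarith

theorem IsDefect.isSmallOn_add (hD : IsDefect D M C) (a b c : ℝ) (ha : 0 ≤ a) (_hab : a ≤ b)
    (_hbc : b ≤ c) (hc : c ≤ 1) (h1 : IsSmallOn D a b) (h2 : IsSmallOn D b c) :
    IsSmallOn D a c := by
  intro η hη
  have hM : 0 < M + 1 := by linarith [hD.one_le]
  have hη' : 0 < η / (M + 1) := by positivity
  have := hD.eventuallyLeOn_add hη'.le ha hc (h1 _ hη') (h2 _ hη')
  rwa [mul_div_cancel₀ _ hM.ne'] at this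

theorem IsDefect.eventuallyLeOn_of_length_le (hD : IsDefect D M C) {a b η : ℝ} (ha : 0 ≤ a)
    (hb : b ≤ 1) (hlen : C * (b - a) ≤ η) : EventuallyLeOn D η a b := by
  filter_upwards [self_mem_nhdsWithin] with ε hε a' b' haa hab hbb
  have hC := hD.const_nonneg
  refine (hD.le ε hε a' b' (ha.trans haa) hab (hbb.trans hb)).trans (le_trans ?_ hlen)
  gcongr

/-- Isolated exceptional points are harmless: cut out a short interval around such a point, on which
the error is at most proportional to the length. -/
theorem IsDefect.locallyAt_of_punctured (hD : IsDefect D M C) {t₀ : ℝ} (ht₀ : t₀ ∈ I)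
    (h : ∀ᶠ s in 𝓝[≠] t₀, s ∈ I → LocallyAt (IsSmallOn D) s) : LocallyAt (IsSmallOn D) t₀ := by
  obtain ⟨δ, hδ, h⟩ := Metric.mem_nhdsWithin_iff.1 h
  have hM := hD.one_le
  have hC := hD.const_nonneg
  -- intervals in the ball that avoid `t₀`
  have hav : ∀ a b : ℝ, 0 ≤ a → a ≤ b → b ≤ 1 → a ∈ Metric.ball t₀ δ → b ∈ Metric.ball t₀ δ →
      t₀ ∉ Icc a b → IsSmallOn D a b := fun a b ha hab hb haδ hbδ hn =>
    interval_of_locallyAt hD.isSmallOn_add ha hab hb fun t ht =>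
      h ⟨(convex_ball t₀ δ).ordConnected.out haδ hbδ ht, fun e => hn (e ▸ ht)⟩
        ⟨ha.trans ht.1, ht.2.trans hb⟩
  have hleft : ∀ a, 0 ≤ a → a ≤ t₀ → a ∈ Metric.ball t₀ δ → IsSmallOn D a t₀ := by
    intro a ha hat haδ η hη
    set η' := η / (M + 1) with hη'
    have hη0 : 0 < η' := by positivity
    have hηe : (M + 1) * η' = η := mul_div_cancel₀ _ (by positivity)
    rw [← hηe]
    have hκ : 0 < η' / (C + 1) := by positivity
    have hCκ : C * (η' / (C + 1)) ≤ η' := by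
      rw [mul_div_assoc', div_le_iff₀ (by positivity)]; nlinarith
    rcases le_total (t₀ - η' / (C + 1)) a with hle | hle
    · refine hD.eventuallyLeOn_of_length_le ha ht₀.2 ?_
      have : C * (t₀ - a) ≤ C * (η' / (C + 1)) := by gcongr; linarith
      nlinarith
    · have hcδ : t₀ - η' / (C + 1) ∈ Metric.ball t₀ δ := (convex_ball t₀ δ).ordConnected.out haδ
        (Metric.mem_ball_self hδ) ⟨hle, by linarith⟩
      refine hD.eventuallyLeOn_add (b := t₀ - η' / (C + 1)) hη0.le ha ht₀.2
        (hav _ _ ha hle (by linarith [ht₀.2]) haδ hcδ (fun hm => by linarith [hm.2]) _ hη0) ?_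
      refine hD.eventuallyLeOn_of_length_le (ha.trans hle) ht₀.2 ?_
      rwa [sub_sub_cancel]
  have hright : ∀ b, t₀ ≤ b → b ≤ 1 → b ∈ Metric.ball t₀ δ → IsSmallOn D t₀ b := by
    intro b htb hb hbδ η hη
    set η' := η / (M + 1) with hη'
    have hη0 : 0 < η' := by positivity
    have hηe : (M + 1) * η' = η := mul_div_cancel₀ _ (by positivity)
    rw [← hηe]
    have hκ : 0 < η' / (C + 1) := by positivity
    have hCκ : C * (η' / (C + 1)) ≤ η' := by
      rw [mul_div_assoc', div_le_iff₀ (by positivity)]; nlinarith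
    rcases le_total b (t₀ + η' / (C + 1)) with hle | hle
    · refine hD.eventuallyLeOn_of_length_le ht₀.1 hb ?_
      have : C * (b - t₀) ≤ C * (η' / (C + 1)) := by gcongr; linarith
      nlinarith
    · have hcδ : t₀ + η' / (C + 1) ∈ Metric.ball t₀ δ := (convex_ball t₀ δ).ordConnected.out
        (Metric.mem_ball_self hδ) hbδ ⟨by linarith, hle⟩
      refine hD.eventuallyLeOn_add (b := t₀ + η' / (C + 1)) hη0.le ht₀.1 hb
        (hD.eventuallyLeOn_of_length_le ht₀.1 (hle.trans hb) (by rwa [add_sub_cancel_left]))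
        (hav _ _ (by linarith [ht₀.1]) hle hb hcδ hbδ (fun hm => by linarith [hm.1]) _ hη0)
  refine ⟨δ, hδ, fun a b ha hab hb haδ hbδ => ?_⟩
  by_cases hm : t₀ ∈ Icc a b
  · exact hD.isSmallOn_add a t₀ b ha hm.1 hm.2 hb (hleft a ha hm.1 haδ) (hright b hm.2 hb hbδ)
  · exact hav a b ha hab hb haδ hbδ hm

/-- Removal of an exceptional set with finitely many accumulation points in two steps: points that
are not accumulation points are at most isolated exceptions, and then so are the accumulation
points. -/
theorem IsDefect.isSmallOn_of_finite_accPt (hD : IsDefect D M C) {N : Set ℝ}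
    (hN : {t | AccPt t (𝓟 N)}.Finite)
    (h : ∀ t ∈ I, (∀ᶠ s in 𝓝[I] t, s ∉ N) → LocallyAt (IsSmallOn D) t) : IsSmallOn D 0 1 := by
  have h1 : ∀ t ∈ I, ¬ AccPt t (𝓟 N) → LocallyAt (IsSmallOn D) t := by
    intro t ht hacc
    have h2 : ∀ᶠ s in 𝓝[≠] t, s ∉ N := by
      rw [accPt_iff_frequently_nhdsNE, not_frequently] at hacc
      exact hacc
    refine hD.locallyAt_of_punctured ht ?_
    filter_upwards [eventually_eventually_nhdsWithin.2 h2, self_mem_nhdsWithin] with s hs hst hsI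
    rw [isOpen_compl_singleton.nhdsWithin_eq hst] at hs
    exact h s hsI (hs.filter_mono nhdsWithin_le_nhds)
  refine interval_of_locallyAt hD.isSmallOn_add le_rfl zero_le_one le_rfl fun t ht => ?_
  refine hD.locallyAt_of_punctured ht ?_
  have h2 : ∀ᶠ s in 𝓝[≠] t, ¬ AccPt s (𝓟 N) := by
    have := (hN.subset (sdiff_subset (t := {t}))).isClosed.isOpen_compl.mem_nhds
      (x := t) (by simp)
    filter_upwards [nhdsWithin_le_nhds this, self_mem_nhdsWithin] with s hs hst hacc
    exact hs ⟨hacc, hst⟩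
  filter_upwards [h2] with s hs hsI
  exact h1 s hsI hs

end Defect

end AdiabaticGap

end

theorem theorem3p3 {X : Type*} [NormedAddCommGroup X] [NormedSpace ℂ X] [CompleteSpace X]
    (m : ℕ∞) (A : ℝ → X →ₗ.[ℂ] X) (σ : ℝ → Set ℂ) (P : ℝ → X →L[ℂ] X)
    (U V : ℝ → ℝ → ℝ → X →L[ℂ] X)
    (hcond : AdiabaticGap.SpectralGapCondition m A σ P U)
    (hV : ∀ ε : ℝ, 0 < ε → AdiabaticGap.IsEvolutionSystem
      (fun t => (AdiabaticGap.commP P t : X →ₗ[ℂ] X) +ᵥ ((1 / ε : ℝ) : ℂ) • A t) (V ε)) :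
    (∀ ε : ℝ, 0 < ε → BddAbove (range fun t : AdiabaticGap.I => ‖U ε t 0 - V ε t 0‖)) ∧
    (m = 0 → (fun ε : ℝ => ⨆ t : AdiabaticGap.I, ‖U ε t 0 - V ε t 0‖)
      =O[𝓝[>] 0] (fun ε : ℝ => ε)) ∧
    (m ≠ 0 → (fun ε : ℝ => ⨆ t : AdiabaticGap.I, ‖U ε t 0 - V ε t 0‖)
      =o[𝓝[>] 0] (fun _ : ℝ => (1 : ℝ))) := by
  open AdiabaticGap in
  obtain ⟨M, hM1, hM⟩ := hcond.evolutions.bounded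
  have hM0 : 0 < M := by linarith
  have hU := hcond.evolutions.evolution
  have hd : ∀ ε : ℝ, ∀ t ∈ I, Dense (((((1 / ε : ℝ) : ℂ) • A t).domain : Submodule ℂ X) : Set X) :=
    fun _ => hcond.evolutions.dense
  obtain ⟨k, hk0, hk, -⟩ := boundedLipschitzOn_commP hcond.regular
  set S := 2 * M * Real.exp (2 * M * k + 1) with hS
  have hVS : ∀ ε > 0, ∀ t ∈ I, ‖V ε t 0‖ ≤ S := fun ε hε =>
    (hU ε hε).norm_le_of_perturbation (hV ε hε) (hd ε) hM0 (hM ε hε) hk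
  have h0I : (0 : ℝ) ∈ I := ⟨le_rfl, zero_le_one⟩
  have hS0 : 0 ≤ S := by positivity
  -- measuring the error on `[a,b]` up to time `b` only makes it independent of later times
  set D : ℝ → ℝ → ℝ → ℝ := fun ε a b => ‖V ε b 0 - U ε b a * V ε a 0‖ with hDdef
  have hD0 : ∀ ε > 0, ∀ t ∈ I, ‖U ε t 0 - V ε t 0‖ = D ε 0 t := fun ε hε t _ => by
    have h1 : V ε 0 0 = 1 := (hV ε hε).self_eq_one (hd ε) h0I
    change _ = ‖V ε t 0 - U ε t 0 * V ε 0 0‖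
    rw [h1, mul_one, norm_sub_rev]
  have hD : IsDefect D M (M * k * S) :=
    { one_le := hM1
      const_nonneg := by positivity
      le := fun ε hε a b ha hab hb =>
        (hU ε hε).norm_sub_comp_le (hV ε hε) (hd ε) hM0 (hM ε hε) hk (hVS ε hε) ha hab hb
      add_le := fun ε hε a b c ha hab hbc hc => by
        have ha' : a ∈ I := ⟨ha, hab.trans (hbc.trans hc)⟩
        have hb' : b ∈ I := ⟨ha.trans hab, hbc.trans hc⟩
        have hc' : c ∈ I := ⟨ha.trans (hab.trans hbc), hc⟩
        have hcoc : U ε c a = U ε c b * U ε b a :=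
          ((hU ε hε).cocycle a b c ⟨ha', hb', hab⟩ ⟨hb', hc', hbc⟩).symm
        have e : V ε c 0 - U ε c a * V ε a 0 = U ε c b * (V ε b 0 - U ε b a * V ε a 0)
            + (V ε c 0 - U ε c b * V ε b 0) := by
          rw [hcoc, mul_sub, mul_assoc]; abel
        change ‖V ε c 0 - U ε c a * V ε a 0‖ ≤ M * ‖V ε b 0 - U ε b a * V ε a 0‖
          + ‖V ε c 0 - U ε c b * V ε b 0‖
        rw [e]
        refine (norm_add_le _ _).trans (add_le_add_left ((norm_mul_le _ _).trans ?_) _)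
        gcongr
        exact hM ε hε b c ⟨hb', hc', hbc⟩ }
  have hloc : ∀ t ∈ I, (∀ᶠ s in 𝓝[I] t, s ∉ fallSet σ fun t => spectrum (A t) \ σ t) →
      LocallyAt (IsOrderOn D) t := by
    intro t ht hN
    obtain ⟨δ, hδ, B, ⟨w, hw0, hw, hwlip⟩, hcomm⟩ := hcond.exists_commutator_solution ht hN
    refine ⟨δ, hδ, fun a b ha hab hb haδ hbδ => ⟨(M * (1 + k) + 1 + M) * S * w, by positivity,
      fun ε hε a' b' haa hab' hbb => ?_⟩⟩
    have hsub : Icc a' b' ⊆ I ∩ Metric.ball t δ := fun s hs =>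
      ⟨⟨ha.trans (haa.trans hs.1), hs.2.trans (hbb.trans hb)⟩,
        (convex_ball t δ).ordConnected.out haδ hbδ ⟨haa.trans hs.1, hs.2.trans hbb⟩⟩
    have hεc : ((ε : ℝ) : ℂ) ≠ 0 := Complex.ofReal_ne_zero.2 hε.ne'
    -- the factor `ε` in `ε • B` compensates the factor `1 / ε` in the generator
    have := (hU ε hε).norm_sub_comp_le_of_commutator (hV ε hε) (hd ε) hM0 (hM ε hε) hk (hVS ε hε)
      (ha.trans haa) hab' (hbb.trans hb) (W := fun s => (ε : ℂ) • B s) (w := w * ε)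
      (by positivity) (fun s hs => by
        rw [norm_smul, Complex.norm_real, Real.norm_of_nonneg hε.le, mul_comm]
        exact mul_le_mul_of_nonneg_right (hw s (hsub hs)) hε.le) (fun s hs r hr => by
        rw [← smul_sub, norm_smul, Complex.norm_real, Real.norm_of_nonneg hε.le, mul_comm,
          mul_right_comm]
        exact mul_le_mul_of_nonneg_right (hwlip s (hsub hs) r (hsub hr)) hε.le) (fun s hs v => by
        obtain ⟨h1, h2⟩ := hcomm s (hsub hs) v
        refine ⟨(A s).domain.smul_mem _ h1, ?_⟩
        have h3 : A s ⟨((ε : ℂ) • B s) v, (A s).domain.smul_mem _ h1⟩ = (ε : ℂ) • A s ⟨B s v, h1⟩ :=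
          (A s).map_smul (ε : ℂ) ⟨B s v, h1⟩
        have h4 : ((1 / ε : ℝ) : ℂ) * (ε : ℂ) = 1 := by
          push_cast
          field_simp
        change (ε : ℂ) • B s (((1 / ε : ℝ) : ℂ) • A s v) - ((1 / ε : ℝ) : ℂ) •
          A s ⟨((ε : ℂ) • B s) v, (A s).domain.smul_mem _ h1⟩ = _
        rw [h3, map_smul, smul_smul, smul_smul, mul_comm (ε : ℂ), h4, one_smul, one_smul, h2])
    refine this.trans_eq ?_
    ring
  have : Nonempty I := ⟨⟨0, h0I⟩⟩
  refine ⟨fun ε hε => ⟨M + S, ?_⟩, fun hm => ?_, fun _ => ?_⟩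
  · rintro _ ⟨t, rfl⟩
    exact (norm_sub_le _ _).trans
      (add_le_add (hM ε hε 0 t ⟨h0I, t.2, t.2.1⟩) (hVS ε hε t t.2))
  · have hN : (fallSet σ fun t => spectrum (A t) \ σ t) = ∅ := by
      rw [← Set.encard_eq_zero, hcond.fall_card, hm]
    obtain ⟨C, hC, h⟩ := interval_of_locallyAt hD.isOrderOn_add le_rfl zero_le_one le_rfl
      fun t ht => hloc t ht (by simp [hN])
    refine IsBigO.of_bound C ?_
    filter_upwards [self_mem_nhdsWithin] with ε hε
    have hε : 0 < ε := hε
    rw [Real.norm_of_nonneg (Real.iSup_nonneg fun _ => norm_nonneg _), Real.norm_of_nonneg hε.le]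
    exact ciSup_le fun t => (hD0 ε hε t t.2).trans_le (h ε hε 0 t le_rfl t.2.1 t.2.2)
  · have hsmall := hD.isSmallOn_of_finite_accPt hcond.fall_acc fun t ht hN =>
      let ⟨δ, hδ, h⟩ := hloc t ht hN
      ⟨δ, hδ, fun a b ha hab hb haδ hbδ => (h a b ha hab hb haδ hbδ).isSmallOn⟩
    rw [isLittleO_iff]
    intro η hη
    filter_upwards [hsmall η hη, self_mem_nhdsWithin] with ε h hε
    have hε : 0 < ε := hε
    rw [Real.norm_of_nonneg (Real.iSup_nonneg fun _ => norm_nonneg _), norm_one, mul_one]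
    exact ciSup_le fun t => (hD0 ε hε t t.2).trans_le (h 0 t le_rfl t.2.1 t.2.2)
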